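/- An atom of a monoid $M$ is an element $a\neq 1$ such that $a=bc$ implies $b=1$ or $c=1$; $M$ is atomic if it is generated by its atoms and, for each $a\in M$, the lengths of the expressions of $a$ as a product of atoms are bounded. Write $a\le_L b$ if $ac=b$, and $a\le_R b$ if $ca=b$, for some $c\in M$. A Garside monoid is a finitely generated, left and right cancellative atomic monoid $M$ such that $(M,\le_L)$ and $(M,\le_R)$ are lattices and $M$ has a Garside element, that is, an element $\Delta$ whose sets of left divisors and of right divisors coincide and generate $M$; the divisors of $\Delta$ are called simple elements. A Garside group is the group of fractions of a Garside monoid. The root problem is solvable in every Garside group (without any finiteness assumption on positive conjugacy classes). That is, every Garside group $G$ is finitely generated and, for every finite generating family $x_1,\dots,x_k$ of $G$, there is an algorithm (a recursive function) which, given a word $w$ in the letters $x_i^{\pm1}$ and an integer $n\ge 2$, returns a word representing some $x\in G$ with $x^n=g$, where $g$ is the element represented by $w$, if such an $x$ exists, and otherwise reports that there is none. Moreover, a single algorithm does this for all Garside groups $G$, where $G$ is given by the finite multiplication table of the simple elements $s_1,\dots,s_m$ of a Garside monoid with group of fractions $G$ and chosen Garside element $\Delta$ (the list of all $(i,j,l)$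 with $s_is_j=s_l$), and elements of $G$ are given by words in the letters $s_i^{\pm1}$. -/

import Mathlib

universe u

namespace Garside

/-- Left divisibility `a ≤_L b`: there is `c` with `a c = b`. -/
def LeftLE {M : Type*} [Monoid M] (a b : M) : Prop := ∃ c : M, a * c = b

/-- Right divisibility `a ≤_R b`: there is `c` with `c a = b`. -/
def RightLE {M : Type*} [Monoid M] (a b : M) : Prop := ∃ c : M, c * a = b

/-- The relation `le` admits a greatest lower bound and a least upper bound for any two elements. -/
def HasMeetsAndJoins {M : Type*} (le : M → M → Prop) : Prop :=
  ∀ a b : M,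
    (∃ d : M, le d a ∧ le d b ∧ ∀ c : M, le c a → le c b → le c d) ∧
    (∃ m : M, le a m ∧ le b m ∧ ∀ c : M, le a c → le b c → le m c)

/-- Atoms: the elements `a ≠ 1` such that `a = b c` only if `b = 1` or `c = 1`. -/
def IsMonoidAtom {M : Type*} [Monoid M] (a : M) : Prop :=
  a ≠ 1 ∧ ∀ b c : M, a = b * c → b = 1 ∨ c = 1

/-- A monoid is atomic if it is generated by its atoms and, for every element `a`, the lengths of
the expressions of `a` as a product of atoms are bounded. -/
structure IsAtomicMonoid (M : Type*) [Monoid M] : Prop where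
  closure_atoms : Submonoid.closure {a : M | IsMonoidAtom a} = ⊤
  bounded : ∀ a : M, ∃ N : ℕ, ∀ l : List M, (∀ x ∈ l, IsMonoidAtom x) → l.prod = a → l.length ≤ N

/-- A Garside element: its left divisors and its right divisors are the same set, and this set
generates the monoid. -/
structure IsGarsideElement {M : Type*} [Monoid M] (Δ : M) : Prop where
  left_eq_right : {a : M | LeftLE a Δ} = {a : M | RightLE a Δ}
  closure_simples : Submonoid.closure {a : M | LeftLE a Δ} = ⊤

/-- Garside monoids. In an atomic monoid `≤_L` and `≤_R` are partial orders, so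
`HasMeetsAndJoins` says that they are lattice orders. -/
structure IsGarsideMonoid (M : Type*) [Monoid M] : Prop where
  atomic : IsAtomicMonoid M
  fg : Monoid.FG M
  left_cancel : ∀ a b c : M, a * b = a * c → b = c
  right_cancel : ∀ a b c : M, b * a = c * a → b = c
  left_lattice : HasMeetsAndJoins (LeftLE (M := M))
  right_lattice : HasMeetsAndJoins (RightLE (M := M))
  exists_garside : ∃ Δ : M, IsGarsideElement Δ

/-- `ι : M → G` exhibits the group `G` as the group of fractions of the monoid `M`: it embeds `M`
in `G`, and every element of `G` is a fraction `a b⁻¹` with `a, b ∈ M`. -/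
structure IsGroupOfFractions {M G : Type*} [Monoid M] [Group G] (ι : M →* G) : Prop where
  injective : Function.Injective ι
  fraction : ∀ g : G, ∃ a b : M, g = ι a * (ι b)⁻¹

/-- A Garside group is the group of fractions of a Garside monoid. -/
def IsGarsideGroup (G : Type u) [Group G] : Prop :=
  ∃ (M : Type u) (_ : Monoid M) (ι : M →* G), IsGarsideMonoid M ∧ IsGroupOfFractions ι

/-- Words in `k` letters and their formal inverses: `(i, true)` is the letter `x_i` and
`(i, false)` its inverse. -/
abbrev GroupWord (k : ℕ) : Type := List (Fin k × Bool)

/-- The element of `G` that a word represents, the letter `x_i` standing for `s i`. -/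
def evalWord {G : Type*} [Group G] {k : ℕ} (s : Fin k → G) (w : GroupWord k) : G :=
  (w.map fun p => if p.2 then s p.1 else (s p.1)⁻¹).prod

/-- `r` is a correct answer to the question of solving `x ^ n = g`, where `g` is represented by the
word `w`: either `r` is a word representing a solution, or `r` is `none` and there is no solution
in `G`. -/
def IsRootAnswer {G : Type*} [Group G] {k : ℕ} (s : Fin k → G) (w : GroupWord k) (n : ℕ) :
    Option (GroupWord k) → Prop
  | some v => evalWord s v ^ n = evalWord s w
  | none => ¬ ∃ x : G, x ^ n = evalWord s w

/-- The root problem is solvable in `G`: the group is finitely generated and, for every finite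
generating family, there is a recursive function which, given a word `w` and an integer `n ≥ 2`,
returns a word for an `n`-th root of the element represented by `w`, or reports that there is
none. -/
def RootProblemSolvable (G : Type*) [Group G] : Prop :=
  Group.FG G ∧
  ∀ (k : ℕ) (s : Fin k → G), Subgroup.closure (Set.range s) = ⊤ →
    ∃ F : GroupWord k × ℕ → Option (GroupWord k), Computable F ∧
      ∀ (w : GroupWord k) (n : ℕ), 2 ≤ n → IsRootAnswer s w n (F (w, n))

/-- `(m, T)` describes the Garside monoid `M` with Garside element `Δ`, through the enumeration `s`:
the family `s` lists the simple elements (the left divisors of `Δ`) without repetition, and the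
finite list `T` consists of the triples `(i, j, l)` such that `s i * s j = s l`. -/
structure IsSimpleTable {M : Type*} [Monoid M] (Δ : M) (m : ℕ) (s : Fin m → M)
    (T : List (ℕ × ℕ × ℕ)) : Prop where
  injective : Function.Injective s
  range_eq : Set.range s = {a : M | LeftLE a Δ}
  mem_table : ∀ t : ℕ × ℕ × ℕ, t ∈ T ↔
    ∃ i j l : Fin m, s i * s j = s l ∧ t = ((i : ℕ), (j : ℕ), (l : ℕ))

/-- A word with its letters written as natural numbers. -/
def codeWord {k : ℕ} (w : GroupWord k) : List (ℕ × Bool) :=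
  w.map fun p => ((p.1 : ℕ), p.2)

end Garside

/-! ### The divisibility order on a Garside group and bounded conjugation -/

namespace Garside

/-! Let `P` be the image of the monoid in `G`, `D` the image of the Garside element, and write `g ≤
h` for `g⁻¹ * h ∈ P`; this order is invariant under left translation and has meets, and conjugation
by `D` preserves `P`. Let `x ^ n = g` with `D ^ (-K) ≤ g ≤ D ^ K`. If `c` is the meet of `1, x, …, x
^ (n - 1)`, then `x * c` is the meet of `x, …, x ^ n`, and the two families differ only in `1` and
`x ^ n`, which are close. Hence `c⁻¹ * x * c` obeys the same bound as `g`
(`exists_bdd_conj_of_pow`).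

The `n`-th power of this conjugate is a conjugate of `g` bounded by `n * K`. The elements with that
bound are finitely many (`finite_bdd`), and conjugate ones are joined by conjugations by simple
elements that never leave the bounded set (`reachable_conjGraph`). A path has fewer edges than there
are bounded elements, so some short word conjugates `g` to `(c⁻¹ * x * c) ^ n`. Conjugating `c⁻¹ * x
* c` back by that word gives a root of `g`, possibly other than `x`, whose length has an explicit
bound (`exists_short_root`). No finiteness of positive conjugacy classes enters.

It remains to test all short words. The word problem is solved from the table by reversing: joins of
simple elements are simple, so the table yields their complements, and these turn any word into a
fraction (`isTrivialWord_iff`). The bound and the test are primitive recursive, uniformly in the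
table. -/

/-- The properties of the submonoid `P` of positive elements and of the Garside element `D` of a
Garside group `G` on which the solution of the root problem rests. -/
structure IsGarsideCone {G : Type*} [Group G] (P : Submonoid G) (D : G) : Prop where
  mem : D ∈ P
  conj_mem_iff : ∀ g : G, D⁻¹ * g * D ∈ P ↔ g ∈ P
  eq_one : ∀ g : G, g ∈ P → g⁻¹ ∈ P → g = 1
  exists_pow : ∀ g : G, ∃ k : ℕ, D ^ k * g ∈ P
  exists_meet : ∀ g h : G, ∃ c : G, c⁻¹ * g ∈ P ∧ c⁻¹ * h ∈ P ∧
    ∀ d : G, d⁻¹ * g ∈ P → d⁻¹ * h ∈ P → d⁻¹ * c ∈ P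

/-- The elements `u` with `D ^ (-K) ≤ u ≤ D ^ K`. -/
def Bdd {G : Type*} [Group G] (P : Submonoid G) (D : G) (K : ℕ) (u : G) : Prop :=
  D ^ K * u ∈ P ∧ D ^ K * u⁻¹ ∈ P

theorem Bdd.inv {G : Type*} [Group G] {P : Submonoid G} {D : G} {K : ℕ} {u : G}
    (hu : Bdd P D K u) : Bdd P D K u⁻¹ :=
  ⟨hu.2, by simpa using hu.1⟩

namespace IsGarsideCone

variable {G : Type*} [Group G] {P : Submonoid G} {D : G}

theorem conj_pow_mem_iff (h : IsGarsideCone P D) (k : ℕ) (g : G) :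
    D ^ k * g * (D ^ k)⁻¹ ∈ P ↔ g ∈ P := by
  induction k with
  | zero => simp
  | succ k ih =>
    rw [← ih, ← h.conj_mem_iff, pow_succ']
    simp only [mul_assoc, mul_inv_rev, inv_mul_cancel_left, inv_mul_cancel, mul_one]

theorem conj_pow_mem (h : IsGarsideCone P D) (k : ℕ) {g : G} (hg : g ∈ P) :
    D ^ k * g * (D ^ k)⁻¹ ∈ P :=
  (h.conj_pow_mem_iff k g).2 hg

theorem pow_mem (h : IsGarsideCone P D) (k : ℕ) : D ^ k ∈ P := Submonoid.pow_mem _ h.mem k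

theorem mul_pow_mem_iff (h : IsGarsideCone P D) (k : ℕ) (g : G) :
    g * D ^ k ∈ P ↔ D ^ k * g ∈ P := by
  rw [← h.conj_pow_mem_iff k]
  simp [mul_assoc]

theorem bdd_conj_pow (h : IsGarsideCone P D) {K : ℕ} {u : G} (hu : Bdd P D K u) (k : ℕ) :
    Bdd P D K (D ^ k * u * (D ^ k)⁻¹) := by
  have key : ∀ v : G, D ^ K * v ∈ P → D ^ K * (D ^ k * v * (D ^ k)⁻¹) ∈ P := fun v hv => by
    have e : D ^ K * (D ^ k * v * (D ^ k)⁻¹) = D ^ k * (D ^ K * v) * (D ^ k)⁻¹ := by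
      simp only [← mul_assoc, ← pow_add, add_comm]
    exact e ▸ h.conj_pow_mem k hv
  refine ⟨key _ hu.1, ?_⟩
  have e : (D ^ k * u * (D ^ k)⁻¹)⁻¹ = D ^ k * u⁻¹ * (D ^ k)⁻¹ := by group
  exact e ▸ key _ hu.2

theorem bdd_mono (h : IsGarsideCone P D) {K L : ℕ} (hKL : K ≤ L) {u : G} (hu : Bdd P D K u) :
    Bdd P D L u := by
  obtain ⟨k, rfl⟩ := Nat.exists_eq_add_of_le' hKL
  simp only [Bdd, pow_add, mul_assoc]
  exact ⟨P.mul_mem (h.pow_mem k) hu.1, P.mul_mem (h.pow_mem k) hu.2⟩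

theorem bdd_mul (h : IsGarsideCone P D) {K L : ℕ} {u v : G} (hu : Bdd P D K u)
    (hv : Bdd P D L v) : Bdd P D (K + L) (u * v) := by
  have key : ∀ (K L : ℕ) (u v : G), D ^ K * u ∈ P → D ^ L * v ∈ P →
      D ^ (K + L) * (u * v) ∈ P := fun K L u v hu hv => by
    have e : D ^ (K + L) * (u * v) = (D ^ L * (D ^ K * u) * (D ^ L)⁻¹) * (D ^ L * v) := by
      rw [add_comm, pow_add]; group
    exact e ▸ P.mul_mem (h.conj_pow_mem L hu) hv
  refine ⟨key _ _ _ _ hu.1 hv.1, ?_⟩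
  rw [mul_inv_rev, add_comm]
  exact key _ _ _ _ hv.2 hu.2

theorem bdd_one : Bdd P D 0 (1 : G) := by
  simp [Bdd, P.one_mem]

theorem bdd_pow (h : IsGarsideCone P D) {K : ℕ} {u : G} (hu : Bdd P D K u) (n : ℕ) :
    Bdd P D (n * K) (u ^ n) := by
  induction n with
  | zero => simpa using bdd_one
  | succ n ih => rw [pow_succ, Nat.succ_mul]; exact h.bdd_mul ih hu

/-- Finitely many elements have a meet. -/
theorem exists_meet_family (h : IsGarsideCone P D) (f : ℕ → G) (n : ℕ) :
    ∃ c : G, (∀ i ≤ n, c⁻¹ * f i ∈ P) ∧ ∀ d : G, (∀ i ≤ n, d⁻¹ * f i ∈ P) → d⁻¹ * c ∈ P := by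
  induction n with
  | zero => exact ⟨f 0, fun i hi => by simp [Nat.le_zero.1 hi], fun d hd => hd 0 le_rfl⟩
  | succ n ih =>
    obtain ⟨c, hc, hmax⟩ := ih
    obtain ⟨e, hec, hef, hemax⟩ := h.exists_meet c (f (n + 1))
    refine ⟨e, fun i hi => ?_, fun d hd =>
      hemax d (hmax d fun i hi => hd i (hi.trans n.le_succ)) (hd _ le_rfl)⟩
    rcases Nat.le_succ_iff.1 hi with hi | rfl
    · have e1 : e⁻¹ * f i = e⁻¹ * c * (c⁻¹ * f i) := by group
      exact e1 ▸ P.mul_mem hec (hc i hi)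
    · exact hef

/-- A root of a bounded element is conjugate to an element that satisfies the same bound. -/
theorem exists_bdd_conj_of_pow (h : IsGarsideCone P D) {K n : ℕ} (hn : n ≠ 0) {x : G}
    (hx : Bdd P D K (x ^ n)) : ∃ c : G, Bdd P D K (c⁻¹ * x * c) := by
  obtain ⟨n, rfl⟩ := Nat.exists_eq_succ_of_ne_zero hn
  -- The exponent is now `n + 1`, and `c` is the meet of `1, x, …, x ^ n`.
  obtain ⟨c, hc, hmax⟩ := h.exists_meet_family (fun i => x ^ i) n
  refine ⟨c, ?_, ?_⟩
  -- The claim is `x⁻¹ * c * D ^ (-K) ≤ c`, tested against each `x ^ i`. For `i < n` it follows from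
  -- `c ≤ x ^ (i + 1)`; for `i = n`, from `c ≤ 1` and the lower bound on `x ^ (n + 1)`.
  · have key := hmax (x⁻¹ * c * (D ^ K)⁻¹) fun i hi => by
      have e : (x⁻¹ * c * (D ^ K)⁻¹)⁻¹ * x ^ i = D ^ K * (c⁻¹ * x ^ (i + 1)) := by
        rw [pow_succ']; group
      rw [e]
      rcases hi.lt_or_eq with hi | rfl
      · exact P.mul_mem (h.pow_mem K) (hc _ hi)
      · have e : D ^ K * (c⁻¹ * x ^ (i + 1)) =
            (D ^ K * (c⁻¹ * x ^ 0) * (D ^ K)⁻¹) * (D ^ K * x ^ (i + 1)) := by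
          rw [pow_zero]; group
        rw [e]
        exact P.mul_mem (h.conj_pow_mem K (hc 0 (Nat.zero_le _))) hx.1
    have e : (x⁻¹ * c * (D ^ K)⁻¹)⁻¹ * c = D ^ K * (c⁻¹ * x * c) := by group
    exact e ▸ key
  -- Here the exceptional index is `i = 0`, settled by `c ≤ x ^ n` and the upper bound on `x ^ (n +
  -- 1)`.
  · have key := hmax (x * c * (D ^ K)⁻¹) fun i hi => by
      have e : (x * c * (D ^ K)⁻¹)⁻¹ * x ^ i = D ^ K * (c⁻¹ * (x⁻¹ * x ^ i)) := by group
      rw [e]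
      rcases i with _ | i
      · have e : D ^ K * (c⁻¹ * (x⁻¹ * x ^ 0)) =
            (D ^ K * (c⁻¹ * x ^ n) * (D ^ K)⁻¹) * (D ^ K * (x ^ (n + 1))⁻¹) := by
          rw [pow_succ', pow_zero]; group
        rw [e]
        exact P.mul_mem (h.conj_pow_mem K (hc n le_rfl)) hx.2
      · rw [pow_succ', inv_mul_cancel_left]
        exact P.mul_mem (h.pow_mem K) (hc _ (Nat.le_of_succ_le hi))
    have e : (x * c * (D ^ K)⁻¹)⁻¹ * c = D ^ K * (c⁻¹ * x * c)⁻¹ := by group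
    exact e ▸ key

/-- Conjugation by the meet of `a` and `D` keeps the bounds that conjugation by `a` keeps. -/
theorem bdd_conj_meet (h : IsGarsideCone P D) {K : ℕ} {u a s : G} (hu : Bdd P D K u)
    (hua : Bdd P D K (a⁻¹ * u * a)) (hsa : s⁻¹ * a ∈ P) (hsD : s⁻¹ * D ∈ P)
    (hmax : ∀ d : G, d⁻¹ * a ∈ P → d⁻¹ * D ∈ P → d⁻¹ * s ∈ P) : Bdd P D K (s⁻¹ * u * s) := by
  have key : ∀ u : G, D ^ K * u ∈ P → D ^ K * (a⁻¹ * u * a) ∈ P →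
      D ^ K * (s⁻¹ * u * s) ∈ P := fun u hu hua => by
    have e : D ^ K * (s⁻¹ * u * s) = (u⁻¹ * s * (D ^ K)⁻¹)⁻¹ * s := by group
    rw [e]
    -- The element `u⁻¹ * s * D ^ (-K)` is below `a` by the bound on the conjugate by `a`, and below
    -- `D` by the bound on `u`; hence it is below their meet `s`.
    apply hmax
    · have e : (u⁻¹ * s * (D ^ K)⁻¹)⁻¹ * a =
          (D ^ K * (s⁻¹ * a) * (D ^ K)⁻¹) * (D ^ K * (a⁻¹ * u * a)) := by group
      exact e ▸ P.mul_mem (h.conj_pow_mem K hsa) hua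
    · have e : (u⁻¹ * s * (D ^ K)⁻¹)⁻¹ * D =
          (D ^ K * (s⁻¹ * D) * (D ^ K)⁻¹) * (D⁻¹ * (D ^ K * u) * D) := by
        have : D⁻¹ * D ^ K = D ^ K * D⁻¹ := by group
        simp only [← mul_assoc, this]
        group
      exact e ▸ P.mul_mem (h.conj_pow_mem K hsD) ((h.conj_mem_iff _).2 hu)
  refine ⟨key u hu.1 hua.1, ?_⟩
  have e : (s⁻¹ * u * s)⁻¹ = s⁻¹ * u⁻¹ * s := by group
  have e' : (a⁻¹ * u * a)⁻¹ = a⁻¹ * u⁻¹ * a := by group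
  rw [e]
  exact key _ hu.2 (e' ▸ hua.2)

/-- Splitting off the meet with `D` from a positive element below `D ^ (k + 1)`. -/
theorem exists_head (h : IsGarsideCone P D) {a : G} (ha : a ∈ P) {k : ℕ}
    (hk : a⁻¹ * D ^ (k + 1) ∈ P) : ∃ s : G, s ∈ P ∧ s⁻¹ * D ∈ P ∧ s⁻¹ * a ∈ P ∧
      (s⁻¹ * a)⁻¹ * D ^ k ∈ P ∧ ∀ d : G, d⁻¹ * a ∈ P → d⁻¹ * D ∈ P → d⁻¹ * s ∈ P := by
  obtain ⟨s, hsa, hsD, hmax⟩ := h.exists_meet a D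
  refine ⟨s, ?_, hsD, hsa, ?_, hmax⟩
  · simpa using hmax 1 (by simpa using ha) (by simpa using h.mem)
  · have e : (s⁻¹ * a)⁻¹ * D ^ k = (D ^ k)⁻¹ * ((a * (D ^ k)⁻¹)⁻¹ * s) * D ^ k := by group
    rw [e, ← h.conj_pow_mem_iff k]
    have e : D ^ k * ((D ^ k)⁻¹ * ((a * (D ^ k)⁻¹)⁻¹ * s) * D ^ k) * (D ^ k)⁻¹ =
        (a * (D ^ k)⁻¹)⁻¹ * s := by group
    rw [e]
    -- `a * D ^ (-k)` is below `a` since `D ^ k` is positive, and below `D` since `a ≤ D ^ (k + 1)`.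
    apply hmax
    · have e : (a * (D ^ k)⁻¹)⁻¹ * a = D ^ k := by group
      rw [e]
      exact h.pow_mem k
    · have e : (a * (D ^ k)⁻¹)⁻¹ * D = D ^ k * (a⁻¹ * D ^ (k + 1)) * (D ^ k)⁻¹ := by
        rw [pow_succ']; group
      exact e ▸ h.conj_pow_mem k hk

/-- A positive element below `D ^ k` is a product of `k` positive elements below `D`. -/
theorem exists_list_of_le_pow (h : IsGarsideCone P D) (k : ℕ) {a : G} (ha : a ∈ P)
    (hk : a⁻¹ * D ^ k ∈ P) :
    ∃ l : List G, l.length = k ∧ (∀ s ∈ l, s ∈ P ∧ s⁻¹ * D ∈ P) ∧ l.prod = a := by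
  induction k generalizing a with
  | zero => exact ⟨[], rfl, by simp, by simpa using (h.eq_one a ha (by simpa using hk)).symm⟩
  | succ k ih =>
    obtain ⟨s, hs, hsD, hsa, hk', -⟩ := h.exists_head ha hk
    obtain ⟨l, hl, hlP, hprod⟩ := ih hsa hk'
    refine ⟨s :: l, by simp [hl], ?_, by simp [hprod]⟩
    simpa [hs, hsD] using hlP

/-- The graph on the bounded elements whose edges are the conjugations by positive elements below
`D`. -/
def conjGraph (P : Submonoid G) (D : G) (K : ℕ) : SimpleGraph {u : G // Bdd P D K u} :=
  SimpleGraph.fromRel fun u v => ∃ s : G, s ∈ P ∧ s⁻¹ * D ∈ P ∧ v.1 = s⁻¹ * u.1 * s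

/-- Peeling meets with `D` off `a` writes it as a product of simple elements, and `bdd_conj_meet`
keeps every intermediate conjugate bounded, so this factorization is traced by a path. -/
theorem reachable_conjGraph_of_mem (h : IsGarsideCone P D) {K : ℕ} (k : ℕ) {a : G} (ha : a ∈ P)
    (hk : a⁻¹ * D ^ k ∈ P) (u v : {u : G // Bdd P D K u}) (huv : v.1 = a⁻¹ * u.1 * a) :
    (conjGraph P D K).Reachable u v := by
  induction k generalizing a u with
  | zero =>
    obtain rfl := h.eq_one a ha (by simpa using hk)
    have : u = v := Subtype.ext (by simpa using huv.symm)
    exact this ▸ SimpleGraph.Reachable.refl _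
  | succ k ih =>
    obtain ⟨s, hs, hsD, hsa, hk', hmax⟩ := h.exists_head ha hk
    have hb := h.bdd_conj_meet u.2 (huv ▸ v.2) hsa hsD hmax
    refine SimpleGraph.Reachable.trans (v := ⟨_, hb⟩) ?_
      (ih hsa hk' ⟨_, hb⟩ (by rw [huv]; group))
    -- `SimpleGraph.fromRel` has no loops, so a conjugation that fixes `u` is not an edge.
    by_cases e : u = ⟨_, hb⟩
    · exact e ▸ SimpleGraph.Reachable.refl _
    · exact SimpleGraph.Adj.reachable
        ((SimpleGraph.fromRel_adj _ _ _).2 ⟨e, Or.inl ⟨s, hs, hsD, rfl⟩⟩)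

/-- Bounded conjugate elements are connected through bounded elements. -/
theorem reachable_conjGraph (h : IsGarsideCone P D) {K : ℕ} (c : G)
    (u v : {u : G // Bdd P D K u}) (huv : v.1 = c⁻¹ * u.1 * c) :
    (conjGraph P D K).Reachable u v := by
  obtain ⟨k, hk⟩ := h.exists_pow c
  obtain ⟨l, hl⟩ := h.exists_pow (D ^ k * c)⁻¹
  -- Both `u` and `v` are conjugates of `w` by positive elements, namely `D ^ k` and `D ^ k * c`.
  let w : {u : G // Bdd P D K u} := ⟨_, h.bdd_conj_pow u.2 k⟩
  have h1 : (conjGraph P D K).Reachable w u :=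
    h.reachable_conjGraph_of_mem k (h.pow_mem k) (by simp [P.one_mem]) w u
      (by simp only [w]; group)
  have h2 : (conjGraph P D K).Reachable w v :=
    h.reachable_conjGraph_of_mem l hk ((h.mul_pow_mem_iff _ _).2 hl) w v
      (by rw [huv]; simp only [w]; group)
  exact h1.symm.trans h2

end IsGarsideCone
end Garside

/-! ### Words, and a bound on the length of a root -/

namespace Garside

section Words

variable {G : Type*} [Group G] {k : ℕ} (s : Fin k → G)

@[simp] theorem evalWord_nil : evalWord s [] = 1 := rfl

@[simp] theorem evalWord_cons (p : Fin k × Bool) (w : GroupWord k) :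
    evalWord s (p :: w) = (if p.2 then s p.1 else (s p.1)⁻¹) * evalWord s w := rfl

@[simp] theorem evalWord_append (v w : GroupWord k) :
    evalWord s (v ++ w) = evalWord s v * evalWord s w := by
  simp [evalWord]

/-- The formal inverse of a word. -/
def invWord {α : Type*} (w : List (α × Bool)) : List (α × Bool) :=
  (w.map fun p => (p.1, !p.2)).reverse

@[simp] theorem length_invWord {α : Type*} (w : List (α × Bool)) :
    (invWord w).length = w.length := by
  simp [invWord]

@[simp] theorem invWord_cons {α : Type*} (p : α × Bool) (w : List (α × Bool)) :
    invWord (p :: w) = invWord w ++ [(p.1, !p.2)] := by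
  simp [invWord]

@[simp] theorem evalWord_invWord (w : GroupWord k) : evalWord s (invWord w) = (evalWord s w)⁻¹ := by
  induction w with
  | nil => simp [invWord]
  | cons p w ih =>
    rw [invWord_cons, evalWord_append, ih]
    rcases p with ⟨i, _ | _⟩ <;> simp

theorem exists_evalWord_eq (g : G) (hg : g ∈ Subgroup.closure (Set.range s)) :
    ∃ w : GroupWord k, evalWord s w = g := by
  induction hg using Subgroup.closure_induction with
  | mem x hx => obtain ⟨i, rfl⟩ := hx; exact ⟨[(i, true)], by simp⟩
  | one => exact ⟨[], rfl⟩
  | mul x y _ _ hx hy =>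
    obtain ⟨v, rfl⟩ := hx
    obtain ⟨w, rfl⟩ := hy
    exact ⟨v ++ w, by simp⟩
  | inv x _ hx => obtain ⟨v, rfl⟩ := hx; exact ⟨invWord v, by simp⟩

end Words

namespace IsGarsideCone

variable {G : Type*} [Group G] {P : Submonoid G} {D : G} {m : ℕ} {s : Fin m → G}

theorem bdd_evalWord (h : IsGarsideCone P D) (hs : Set.range s = {g | g ∈ P ∧ g⁻¹ * D ∈ P})
    (w : GroupWord m) : Bdd P D w.length (evalWord s w) := by
  induction w with
  | nil => exact bdd_one
  | cons p w ih =>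
    rw [evalWord_cons, List.length_cons, add_comm]
    refine h.bdd_mul ?_ ih
    have hp : s p.1 ∈ P ∧ (s p.1)⁻¹ * D ∈ P := hs.subset ⟨p.1, rfl⟩
    have hb : Bdd P D 1 (s p.1) :=
      ⟨P.mul_mem (h.pow_mem 1) hp.1, (h.mul_pow_mem_iff 1 _).1 (by simpa using hp.2)⟩
    split
    · exact hb
    · exact hb.inv

/-- Normal form of a bounded element. -/
theorem exists_list_of_bdd (h : IsGarsideCone P D)
    (hs : Set.range s = {g | g ∈ P ∧ g⁻¹ * D ∈ P}) {K : ℕ} {u : G} (hu : Bdd P D K u) :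
    ∃ l : List (Fin m), l.length = 2 * K ∧ u = (D ^ K)⁻¹ * (l.map s).prod := by
  obtain ⟨l, hl, hlP, hprod⟩ := h.exists_list_of_le_pow (2 * K) hu.1 (by
    have e : (D ^ K * u)⁻¹ * D ^ (2 * K) = u⁻¹ * D ^ K := by rw [two_mul, pow_add]; group
    rw [e, h.mul_pow_mem_iff]
    exact hu.2)
  have hmem : l ∈ Set.range (List.map s) := by
    rw [Set.range_list_map]
    exact fun x hx => hs.superset (hlP x hx)
  obtain ⟨l', rfl⟩ := hmem
  exact ⟨l', by simpa using hl, by rw [hprod]; group⟩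

/-- Normal forms inject the bounded elements into vectors of `2 * K` letters; the count later bounds
the length of a path. -/
theorem finite_bdd (h : IsGarsideCone P D) (hs : Set.range s = {g | g ∈ P ∧ g⁻¹ * D ∈ P})
    (K : ℕ) : Finite {u : G // Bdd P D K u} ∧ Nat.card {u : G // Bdd P D K u} ≤ m ^ (2 * K) := by
  choose f hf hfu using fun u : {u : G // Bdd P D K u} => h.exists_list_of_bdd hs u.2
  let φ : {u : G // Bdd P D K u} → List.Vector (Fin m) (2 * K) := fun u => ⟨f u, hf u⟩
  have hφ : Function.Injective φ := fun u v huv => Subtype.ext (by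
    rw [hfu u, hfu v, show f u = f v from congrArg Subtype.val huv])
  refine ⟨Finite.of_injective φ hφ, ?_⟩
  simpa using Nat.card_le_card_of_injective φ hφ

/-- Edges are symmetrized conjugations, so an edge traversed backwards contributes an inverse
letter. -/
theorem exists_word_of_walk (hs : Set.range s = {g | g ∈ P ∧ g⁻¹ * D ∈ P}) {K : ℕ}
    {u v : {u : G // Bdd P D K u}} (p : (conjGraph P D K).Walk u v) :
    ∃ w : GroupWord m, w.length = p.length ∧ v.1 = (evalWord s w)⁻¹ * u.1 * evalWord s w := by
  induction p with
  | nil => exact ⟨[], rfl, by simp⟩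
  | @cons a b c hab q ih =>
    obtain ⟨w, hw, he⟩ := ih
    rcases ((SimpleGraph.fromRel_adj _ _ _).1 hab).2 with ⟨t, ht, htD, e⟩ | ⟨t, ht, htD, e⟩
    · obtain ⟨i, rfl⟩ := hs.superset ⟨ht, htD⟩
      refine ⟨(i, true) :: w, by simp [hw], ?_⟩
      rw [he, e, evalWord_cons, if_pos rfl]
      group
    · obtain ⟨i, rfl⟩ := hs.superset ⟨ht, htD⟩
      refine ⟨(i, false) :: w, by simp [hw], ?_⟩
      rw [he, e, evalWord_cons, if_neg (by simp)]
      group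

/-- If an element has an `n`-th root, it has one that is represented by a short word. -/
theorem exists_short_root (h : IsGarsideCone P D)
    (hs : Set.range s = {g | g ∈ P ∧ g⁻¹ * D ∈ P}) (w : GroupWord m) {n : ℕ} (hn : n ≠ 0)
    {x : G} (hx : x ^ n = evalWord s w) :
    ∃ v : GroupWord m, v.length ≤ 3 * (n * w.length) + 2 * m ^ (2 * (n * w.length)) ∧
      evalWord s v ^ n = evalWord s w := by
  have hw := h.bdd_evalWord hs w
  have hle : w.length ≤ n * w.length := Nat.le_mul_of_pos_left _ (Nat.pos_of_ne_zero hn)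
  obtain ⟨c, hc⟩ := h.exists_bdd_conj_of_pow hn (hx ▸ hw)
  -- The conjugate of `x` is bounded by `w.length`; its `n`-th power needs `n * w.length`, which
  -- also bounds `evalWord s w`.
  set K := n * w.length
  have hconj : (c⁻¹ * x * c) ^ n = c⁻¹ * evalWord s w * c := by
    rw [← hx]; simpa using conj_pow (a := c⁻¹) (b := x) (i := n)
  obtain ⟨hfin, hcard⟩ := h.finite_bdd hs K
  obtain ⟨p, hp⟩ := (h.reachable_conjGraph (K := K) c ⟨_, h.bdd_mono hle hw⟩
    ⟨_, h.bdd_pow hc n⟩ hconj).exists_isPath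
  obtain ⟨e, he, hev⟩ := exists_word_of_walk hs p
  have hlen : e.length ≤ m ^ (2 * K) := by
    have := Fintype.ofFinite {u : G // Bdd P D K u}
    rw [he]
    exact (hp.length_lt.le.trans_eq Nat.card_eq_fintype_card.symm).trans hcard
  obtain ⟨l, hl, hlx⟩ := h.exists_list_of_bdd hs hc
  obtain ⟨d, hd⟩ := hs.superset (show D ∈ _ from ⟨h.mem, by simp [P.one_mem]⟩)
  -- The normal form of `c⁻¹ * x * c`: `w.length` letters `D⁻¹` and `2 * w.length` simple letters,
  -- whence the factor 3.
  let y : GroupWord m := List.replicate w.length (d, false) ++ l.map fun i => (i, true)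
  have hy : evalWord s y = c⁻¹ * x * c := by
    rw [hlx, evalWord_append]
    simp [evalWord, hd, Function.comp_def]
  refine ⟨e ++ y ++ invWord e, ?_, ?_⟩
  · simp only [List.length_append, length_invWord, y, List.length_replicate, List.length_map, hl]
    omega
  · simp only [evalWord_append, evalWord_invWord, hy, conj_pow]
    rw [show (c⁻¹ * x * c) ^ n = _ from hev]
    group

end IsGarsideCone
end Garside

/-! ### From a Garside monoid to the positive cone of its group -/

namespace Garside

section Monoid

variable {M : Type*} [Monoid M]

/-- Otherwise repeating an atomic expression of `a * b` would express `1` by arbitrarily many atoms.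
-/
theorem IsAtomicMonoid.eq_one_of_mul_eq_one (hM : IsAtomicMonoid M) {a b : M} (hab : a * b = 1) :
    a = 1 := by
  obtain ⟨l, hl, rfl⟩ := Submonoid.exists_list_of_mem_closure
    (hM.closure_atoms.symm ▸ Submonoid.mem_top a)
  obtain ⟨l', hl', rfl⟩ := Submonoid.exists_list_of_mem_closure
    (hM.closure_atoms.symm ▸ Submonoid.mem_top b)
  obtain ⟨N, hN⟩ := hM.bounded 1
  have key := hN (List.replicate (N + 1) (l ++ l')).flatten
    (fun x hx => by
      obtain ⟨y, hy, hxy⟩ := List.mem_flatten.1 hx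
      obtain rfl := List.eq_of_mem_replicate hy
      exact (List.mem_append.1 hxy).elim (hl x) (hl' x))
    (by simp [List.prod_flatten, hab])
  have hnil : l.length = 0 := by
    simp only [List.length_flatten, List.map_replicate, List.sum_replicate, List.length_append,
      smul_eq_mul] at key
    nlinarith
  simp [List.eq_nil_of_length_eq_zero hnil]

namespace IsGarsideMonoid

theorem leftLE_antisymm (hM : IsGarsideMonoid M) {a b : M} (hab : LeftLE a b)
    (hba : LeftLE b a) : a = b := by
  obtain ⟨x, rfl⟩ := hab
  obtain ⟨y, hy⟩ := hba
  have hxy : x * y = 1 := hM.left_cancel a _ _ (by rw [← mul_assoc, hy, mul_one])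
  rw [hM.atomic.eq_one_of_mul_eq_one hxy, mul_one]

/-- Every generating set contains all atoms. -/
theorem finite_atoms (hM : IsGarsideMonoid M) : {a : M | IsMonoidAtom a}.Finite := by
  obtain ⟨S, hS⟩ := hM.fg.fg_top
  refine S.finite_toSet.subset fun a ha => ?_
  obtain ⟨l, hl, rfl⟩ := Submonoid.exists_list_of_mem_closure
    (hS.symm ▸ Submonoid.mem_top a)
  induction l with
  | nil => exact absurd rfl ha.1
  | cons x l ih =>
    rw [List.prod_cons] at ha ⊢
    rcases ha.2 _ _ rfl with h | h
    · rw [h, one_mul] at ha ⊢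
      exact ih (fun y hy => hl y (List.mem_cons_of_mem _ hy)) ha
    · rw [h, mul_one]
      exact hl x List.mem_cons_self

/-- An element of a Garside monoid has finitely many left divisors. -/
theorem finite_leftLE (hM : IsGarsideMonoid M) (b : M) : {a : M | LeftLE a b}.Finite := by
  obtain ⟨N, hN⟩ := hM.atomic.bounded b
  have := hM.finite_atoms.to_subtype
  refine ((List.finite_length_le {a : M | IsMonoidAtom a} N).image
    fun l => (l.map Subtype.val).prod).subset ?_
  rintro a ⟨c, rfl⟩
  obtain ⟨l, hl, rfl⟩ := Submonoid.exists_list_of_mem_closure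
    (hM.atomic.closure_atoms.symm ▸ Submonoid.mem_top a)
  obtain ⟨l', hl', rfl⟩ := Submonoid.exists_list_of_mem_closure
    (hM.atomic.closure_atoms.symm ▸ Submonoid.mem_top c)
  have hlen := hN (l ++ l') (fun x hx => (List.mem_append.1 hx).elim (hl x) (hl' x)) (by simp)
  lift l to List {a : M | IsMonoidAtom a} using hl
  refine ⟨l, ?_, rfl⟩
  simp only [List.length_append, List.length_map] at hlen
  exact Nat.le_of_add_right_le hlen

end IsGarsideMonoid

namespace IsGarsideElement

variable {Δ : M}

theorem leftLE_of_mul_right (hΔ : IsGarsideElement Δ) {a b : M} (h : LeftLE (a * b) Δ) :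
    LeftLE b Δ := by
  obtain ⟨x, hx⟩ := h
  have : RightLE (b * x) Δ := ⟨a, by rw [← mul_assoc, hx]⟩
  obtain ⟨y, hy⟩ := hΔ.left_eq_right.superset this
  exact ⟨x * y, by rw [← mul_assoc, hy]⟩

/-- If `x * y = Δ`, then `y` is also a left divisor, say `y * z = Δ`, and `x * Δ = x * y * z' = Δ *
z'` with `z' = z` after regrouping: `x * (y * z) = (x * y) * z`. -/
theorem exists_mul_eq (hΔ : IsGarsideElement Δ) (a : M) : ∃ b : M, a * Δ = Δ * b := by
  have ha : a ∈ Submonoid.closure {a : M | LeftLE a Δ} := hΔ.closure_simples ▸ Submonoid.mem_top a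
  induction ha using Submonoid.closure_induction with
  | mem x hx =>
    obtain ⟨y, hy⟩ := hx
    obtain ⟨z, hz⟩ := hΔ.left_eq_right.superset (show RightLE y Δ from ⟨x, hy⟩)
    exact ⟨z, by rw [← hy, mul_assoc, hz, hy]⟩
  | one => exact ⟨1, by simp⟩
  | mul x y _ _ hx hy =>
    obtain ⟨x', hx⟩ := hx
    obtain ⟨y', hy⟩ := hy
    exact ⟨x' * y', by rw [mul_assoc, hy, ← mul_assoc, hx, mul_assoc]⟩

theorem exists_eq_mul (hΔ : IsGarsideElement Δ) (b : M) : ∃ a : M, a * Δ = Δ * b := by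
  have hb : b ∈ Submonoid.closure {a : M | LeftLE a Δ} := hΔ.closure_simples ▸ Submonoid.mem_top b
  induction hb using Submonoid.closure_induction with
  | mem x hx =>
    obtain ⟨y, hy⟩ := hΔ.left_eq_right.subset hx
    obtain ⟨z, hz⟩ := hΔ.left_eq_right.subset (show LeftLE y Δ from ⟨x, hy⟩)
    exact ⟨z, by conv_rhs => rw [← hz, mul_assoc, hy]⟩
  | one => exact ⟨1, by simp⟩
  | mul x y _ _ hx hy =>
    obtain ⟨x', hx⟩ := hx
    obtain ⟨y', hy⟩ := hy
    exact ⟨x' * y', by rw [mul_assoc, hy, ← mul_assoc, hx, mul_assoc]⟩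

end IsGarsideElement

variable {G : Type*} [Group G] {ι : M →* G} {Δ : M}

theorem IsGroupOfFractions.inv_mul_mem_mrange_iff (hι : IsGroupOfFractions ι) (a b : M) :
    (ι a)⁻¹ * ι b ∈ MonoidHom.mrange ι ↔ LeftLE a b := by
  constructor
  · rintro ⟨c, hc⟩
    exact ⟨c, hι.injective (by rw [map_mul, hc, mul_inv_cancel_left])⟩
  · rintro ⟨c, rfl⟩
    exact ⟨c, by simp⟩

theorem conj_mem_mrange_iff (hΔ : IsGarsideElement Δ) (g : G) :
    (ι Δ)⁻¹ * g * ι Δ ∈ MonoidHom.mrange ι ↔ g ∈ MonoidHom.mrange ι := by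
  constructor
  · rintro ⟨b, hb⟩
    obtain ⟨a, ha⟩ := hΔ.exists_eq_mul b
    refine ⟨a, mul_right_cancel (b := ι Δ) ?_⟩
    rw [← map_mul, ha, map_mul, hb]
    group
  · rintro ⟨a, rfl⟩
    obtain ⟨b, hb⟩ := hΔ.exists_mul_eq a
    exact ⟨b, by rw [mul_assoc, ← map_mul, hb, map_mul, inv_mul_cancel_left]⟩

/-- The submonoid of positive elements of a Garside group. -/
theorem IsGroupOfFractions.isGarsideCone (hι : IsGroupOfFractions ι) (hM : IsGarsideMonoid M)
    (hΔ : IsGarsideElement Δ) : IsGarsideCone (MonoidHom.mrange ι) (ι Δ) := by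
  have conj_pow (k : ℕ) (g : G) (hg : g ∈ MonoidHom.mrange ι) :
      (ι Δ ^ k)⁻¹ * g * ι Δ ^ k ∈ MonoidHom.mrange ι := by
    induction k with
    | zero => simpa using hg
    | succ k ih =>
      have e : (ι Δ ^ (k + 1))⁻¹ * g * ι Δ ^ (k + 1) =
          (ι Δ)⁻¹ * ((ι Δ ^ k)⁻¹ * g * ι Δ ^ k) * ι Δ := by rw [pow_succ]; group
      exact e ▸ (conj_mem_mrange_iff hΔ _).2 ih
  have conj_pow' (k : ℕ) (g : G) (hg : g ∈ MonoidHom.mrange ι) :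
      ι Δ ^ k * g * (ι Δ ^ k)⁻¹ ∈ MonoidHom.mrange ι := by
    induction k with
    | zero => simpa using hg
    | succ k ih =>
      rw [← conj_mem_mrange_iff hΔ]
      have e : (ι Δ)⁻¹ * (ι Δ ^ (k + 1) * g * (ι Δ ^ (k + 1))⁻¹) * ι Δ =
          ι Δ ^ k * g * (ι Δ ^ k)⁻¹ := by rw [pow_succ']; group
      exact e ▸ ih
  have le_pow (b : M) : ∃ k : ℕ, (ι b)⁻¹ * ι Δ ^ k ∈ MonoidHom.mrange ι := by
    have hb : b ∈ Submonoid.closure {a : M | LeftLE a Δ} :=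
      hΔ.closure_simples ▸ Submonoid.mem_top b
    induction hb using Submonoid.closure_induction with
    | mem x hx => exact ⟨1, by rw [pow_one]; exact (hι.inv_mul_mem_mrange_iff _ _).2 hx⟩
    | one => exact ⟨0, by simp⟩
    | mul x y _ _ hx hy =>
      obtain ⟨k, hk⟩ := hx
      obtain ⟨l, hl⟩ := hy
      refine ⟨k + l, ?_⟩
      have e : (ι (x * y))⁻¹ * ι Δ ^ (k + l) =
          ((ι y)⁻¹ * ι Δ ^ l) * ((ι Δ ^ l)⁻¹ * ((ι x)⁻¹ * ι Δ ^ k) * ι Δ ^ l) := by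
        rw [map_mul, pow_add]; group
      exact e ▸ mul_mem hl (conj_pow l _ hk)
  have exists_pow (g : G) : ∃ k : ℕ, ι Δ ^ k * g ∈ MonoidHom.mrange ι := by
    obtain ⟨a, b, rfl⟩ := hι.fraction g
    obtain ⟨k, hk⟩ := le_pow b
    refine ⟨k, ?_⟩
    have e : ι Δ ^ k * (ι a * (ι b)⁻¹) =
        ι Δ ^ k * (ι a * ((ι b)⁻¹ * ι Δ ^ k)) * (ι Δ ^ k)⁻¹ := by group
    exact e ▸ conj_pow' k _ (mul_mem ⟨a, rfl⟩ hk)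
  refine ⟨⟨Δ, rfl⟩, conj_mem_mrange_iff hΔ, ?_, exists_pow, ?_⟩
  · rintro _ ⟨a, rfl⟩ ⟨b, hb⟩
    have hab : a * b = 1 := hι.injective (by rw [map_mul, hb, map_one, mul_inv_cancel])
    rw [hM.atomic.eq_one_of_mul_eq_one hab, map_one]
  · intro g h
    obtain ⟨k, hk⟩ := exists_pow g
    obtain ⟨l, hl⟩ := exists_pow h
    obtain ⟨a, ha⟩ : ι Δ ^ (k + l) * g ∈ MonoidHom.mrange ι := by
      rw [add_comm, pow_add, mul_assoc]
      exact mul_mem (pow_mem (MonoidHom.mem_mrange.2 ⟨Δ, rfl⟩) l) hk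
    obtain ⟨b, hb⟩ : ι Δ ^ (k + l) * h ∈ MonoidHom.mrange ι := by
      rw [pow_add, mul_assoc]
      exact mul_mem (pow_mem (MonoidHom.mem_mrange.2 ⟨Δ, rfl⟩) k) hl
    set z := ι Δ ^ (k + l) with hz
    obtain rfl : g = z⁻¹ * ι a := by rw [ha, inv_mul_cancel_left]
    obtain rfl : h = z⁻¹ * ι b := by rw [hb, inv_mul_cancel_left]
    obtain ⟨⟨d, hda, hdb, hmax⟩, -⟩ := hM.left_lattice a b
    have cancel (x y : G) : (z⁻¹ * x)⁻¹ * (z⁻¹ * y) = x⁻¹ * y := by group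
    refine ⟨z⁻¹ * ι d, ?_, ?_, fun e hea heb => ?_⟩
    · rw [cancel]; exact (hι.inv_mul_mem_mrange_iff _ _).2 hda
    · rw [cancel]; exact (hι.inv_mul_mem_mrange_iff _ _).2 hdb
    · obtain ⟨j, hj⟩ := exists_pow (z * e)
      obtain ⟨f, hf⟩ := hj
      obtain rfl : e = z⁻¹ * ((ι Δ ^ j)⁻¹ * ι f) := by rw [hf]; group
      rw [cancel] at hea heb ⊢
      -- The competitor `e` becomes positive only after a further shift by `Δ ^ j`. The meet of `Δ ^
      -- j * a` and `Δ ^ j * b` is a multiple `Δ ^ j * c`, and `c` divides `d` after cancellation.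
      obtain ⟨⟨d', hda', hdb', hmax'⟩, -⟩ := hM.left_lattice (Δ ^ j * a) (Δ ^ j * b)
      have shift (x : M) : ((ι Δ ^ j)⁻¹ * ι f)⁻¹ * ι x = (ι f)⁻¹ * ι (Δ ^ j * x) := by
        rw [map_mul, map_pow]; group
      rw [shift, hι.inv_mul_mem_mrange_iff] at hea heb ⊢
      obtain ⟨c, rfl⟩ := hmax' _ ⟨a, rfl⟩ ⟨b, rfl⟩
      have cancel' (x : M) (h : LeftLE (Δ ^ j * c) (Δ ^ j * x)) : LeftLE c x := by
        obtain ⟨y, hy⟩ := h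
        exact ⟨y, hM.left_cancel (Δ ^ j) _ _ (by rw [← mul_assoc, hy])⟩
      obtain ⟨x, rfl⟩ := hmax c (cancel' a hda') (cancel' b hdb')
      obtain ⟨y, hy⟩ := hmax' f hea heb
      exact ⟨y * x, by rw [← mul_assoc, hy, mul_assoc]⟩

theorem IsSimpleTable.range_map_eq {m : ℕ} {s : Fin m → M} {T : List (ℕ × ℕ × ℕ)}
    (hT : IsSimpleTable Δ m s T) (hι : IsGroupOfFractions ι) :
    Set.range (fun i => ι (s i)) =
      {g | g ∈ MonoidHom.mrange ι ∧ g⁻¹ * ι Δ ∈ MonoidHom.mrange ι} := by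
  ext g
  constructor
  · rintro ⟨i, rfl⟩
    exact ⟨⟨s i, rfl⟩, (hι.inv_mul_mem_mrange_iff _ _).2 (hT.range_eq.subset ⟨i, rfl⟩)⟩
  · rintro ⟨⟨a, rfl⟩, ha⟩
    obtain ⟨i, rfl⟩ := hT.range_eq.superset ((hι.inv_mul_mem_mrange_iff _ _).1 ha)
    exact ⟨i, rfl⟩

end Monoid
end Garside

/-! ### The algorithm -/

namespace Garside

section Algorithm

/-- According to the table `T`, the simple element `a` divides the simple element `c`. -/
def tableDvd (T : List (ℕ × ℕ × ℕ)) (a c : ℕ) : Bool :=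
  T.any fun p => p.1 == a && p.2.2 == c

/-- According to the table `T`, the simple element `c` is the join of `a` and `b`. -/
def tableJoin (T : List (ℕ × ℕ × ℕ)) (a b c : ℕ) : Bool :=
  tableDvd T a c && tableDvd T b c &&
    T.all fun p => !(tableDvd T a p.2.2 && tableDvd T b p.2.2) || tableDvd T c p.2.2

/-- The complement of `a` in the join of `a` and `b`. -/
def complement (T : List (ℕ × ℕ × ℕ)) (a b : ℕ) : ℕ :=
  -- The default 0 is never reached when `T` is a table and `a`, `b` index simple elements.
  ((T.find? fun p => p.1 == a && tableJoin T a b p.2.2).map fun p => p.2.1).getD 0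

/-- According to the table `T`, the simple element `a` is the identity. -/
def tableOne (T : List (ℕ × ℕ × ℕ)) (a : ℕ) : Bool := T.any fun p => p.1 == a && p.2.1 == a && p.2.2 == a

/-- The complements in the join of a simple element and of a product of simple elements, the first
one appended to a given list. -/
def reverseLetter (T : List (ℕ × ℕ × ℕ)) (st : List ℕ × ℕ) (l : List ℕ) : List ℕ × ℕ :=
  l.foldl (fun st b => (st.1 ++ [complement T st.2 b], complement T b st.2)) st

/-- Multiplication of a right fraction by a letter. -/
def letterMul (T : List (ℕ × ℕ × ℕ)) (p : ℕ × Bool) (r : List ℕ × List ℕ) : List ℕ × List ℕ :=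
  if p.2 then (p.1 :: r.1, r.2) else
    ((reverseLetter T ([], p.1) r.1).1, r.2 ++ [(reverseLetter T ([], p.1) r.1).2])

/-- Word reversing: the right fraction that a word represents. -/
def toFraction (T : List (ℕ × ℕ × ℕ)) (w : List (ℕ × Bool)) : List ℕ × List ℕ :=
  w.foldr (letterMul T) ([], [])

/-- The word that represents the left fraction `b⁻¹ a`. -/
def leftFractionWord (b a : List ℕ) : List (ℕ × Bool) :=
  invWord (b.map fun i => (i, true)) ++ a.map fun i => (i, true)

/-- The word problem. -/
def isTrivialWord (T : List (ℕ × ℕ × ℕ)) (w : List (ℕ × Bool)) : Bool :=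
  let r := toFraction T w
  let q := toFraction T (leftFractionWord r.2 r.1)
  q.1.all (tableOne T) && q.2.all (tableOne T)

/-- The words of length at most `B` in `m` letters. -/
def shortWords (m B : ℕ) : List (List (ℕ × Bool)) :=
  B.rec [[]] fun _ W => [] :: W.flatMap fun v =>
    (List.range m).flatMap fun i => [(i, true) :: v, (i, false) :: v]

/-- The `n`-th power of a word. -/
def wordPow {α : Type*} (v : List α) (n : ℕ) : List α := n.rec [] fun _ u => v ++ u

/-- A bound for the length of a root. -/
def rootBound (m K : ℕ) : ℕ := 3 * K + 2 * m ^ (2 * K)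

/-- Root extraction in the Garside group with the table `T` for its `m` simple elements. -/
def extractRoot (x : (ℕ × List (ℕ × ℕ × ℕ)) × List (ℕ × Bool) × ℕ) :
    Option (List (ℕ × Bool)) :=
  (shortWords x.1.1 (rootBound x.1.1 (x.2.2 * x.2.1.length))).find? fun v =>
    isTrivialWord x.1.2 (wordPow v x.2.2 ++ invWord x.2.1)

end Algorithm

/-! ### Correctness of word reversing and of the search -/

section Correctness

/-- The family `s`, extended to the natural numbers by `1`. -/
def extendOne {M : Type*} [Monoid M] {m : ℕ} (s : Fin m → M) (i : ℕ) : M :=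
  if h : i < m then s ⟨i, h⟩ else 1

theorem extendOne_val {M : Type*} [Monoid M] {m : ℕ} (s : Fin m → M) (i : Fin m) :
    extendOne s i = s i := dif_pos i.2

/-- The element that a word with letters coded by natural numbers represents. -/
def evalCode {G : Type*} [Group G] (t : ℕ → G) (w : List (ℕ × Bool)) : G :=
  (w.map fun p => if p.2 then t p.1 else (t p.1)⁻¹).prod

section EvalCode

variable {G : Type*} [Group G] (t : ℕ → G)

@[simp] theorem evalCode_nil : evalCode t [] = 1 := rfl

@[simp] theorem evalCode_cons (p : ℕ × Bool) (w : List (ℕ × Bool)) :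
    evalCode t (p :: w) = (if p.2 then t p.1 else (t p.1)⁻¹) * evalCode t w := rfl

@[simp] theorem evalCode_append (v w : List (ℕ × Bool)) :
    evalCode t (v ++ w) = evalCode t v * evalCode t w := by
  simp [evalCode]

@[simp] theorem evalCode_invWord (w : List (ℕ × Bool)) :
    evalCode t (invWord w) = (evalCode t w)⁻¹ := by
  induction w with
  | nil => simp [invWord]
  | cons p w ih =>
    rw [invWord_cons, evalCode_append, ih]
    rcases p with ⟨i, _ | _⟩ <;> simp

@[simp] theorem evalCode_wordPow (w : List (ℕ × Bool)) (n : ℕ) :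
    evalCode t (wordPow w n) = evalCode t w ^ n := by
  induction n with
  | zero => simp [wordPow]
  | succ n ih => rw [pow_succ', ← ih, ← evalCode_append]; rfl

@[simp] theorem evalCode_map_true (l : List ℕ) :
    evalCode t (l.map fun i => (i, true)) = (l.map t).prod := by
  simp [evalCode, Function.comp_def]

end EvalCode

theorem mem_shortWords {m B : ℕ} {v : List (ℕ × Bool)} :
    v ∈ shortWords m B ↔ v.length ≤ B ∧ ∀ p ∈ v, p.1 < m := by
  induction B generalizing v with
  | zero =>
    cases v <;> simp [shortWords]
  | succ B ih =>
    have e : shortWords m (B + 1) = [] :: (shortWords m B).flatMap fun v =>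
      (List.range m).flatMap fun i => [(i, true) :: v, (i, false) :: v] := rfl
    rw [e]
    rcases v with _ | ⟨⟨i, b⟩, v⟩
    · simp
    · simp only [List.mem_cons, reduceCtorEq, false_or, List.mem_flatMap, ih, List.mem_range,
        List.not_mem_nil, or_false, List.cons.injEq, Prod.mk.injEq]
      constructor
      · rintro ⟨u, hu, j, hj, ⟨⟨rfl, rfl⟩, rfl⟩ | ⟨⟨rfl, rfl⟩, rfl⟩⟩ <;>
        · refine ⟨by simpa using hu.1, ?_⟩
          simpa [hj] using hu.2
      · rintro ⟨h1, h2⟩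
        refine ⟨v, ⟨by simpa using h1, fun p hp => h2 p (Or.inr hp)⟩, i,
          h2 (i, b) (Or.inl rfl), ?_⟩
        cases b <;> simp

theorem exists_codeWord_eq {m : ℕ} (v : List (ℕ × Bool)) (hv : ∀ p ∈ v, p.1 < m) :
    ∃ w : GroupWord m, codeWord w = v := by
  induction v with
  | nil => exact ⟨[], rfl⟩
  | cons p v ih =>
    obtain ⟨w, rfl⟩ := ih fun q hq => hv q (List.mem_cons_of_mem _ hq)
    exact ⟨(⟨p.1, hv p List.mem_cons_self⟩, p.2) :: w, rfl⟩

theorem codeWord_lt {m : ℕ} (w : GroupWord m) : ∀ p ∈ codeWord w, p.1 < m := by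
  simp only [codeWord, List.mem_map]
  rintro _ ⟨q, -, rfl⟩
  exact q.1.2

namespace IsSimpleTable

variable {M : Type*} [Monoid M] {Δ : M} {m : ℕ} {s : Fin m → M} {T : List (ℕ × ℕ × ℕ)}

local notation "σ" => extendOne s

theorem mem_iff (hT : IsSimpleTable Δ m s T) {i j l : ℕ} :
    (i, j, l) ∈ T ↔ i < m ∧ j < m ∧ l < m ∧ σ i * σ j = σ l := by
  rw [hT.mem_table]
  constructor
  · rintro ⟨i, j, l, h, e⟩
    simp only [Prod.mk.injEq] at e
    obtain ⟨rfl, rfl, rfl⟩ := e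
    exact ⟨i.2, j.2, l.2, by simpa only [extendOne_val] using h⟩
  · rintro ⟨hi, hj, hl, h⟩
    refine ⟨⟨i, hi⟩, ⟨j, hj⟩, ⟨l, hl⟩, ?_, rfl⟩
    simpa only [extendOne, hi, hj, hl, dif_pos] using h

theorem leftLE_garside (hT : IsSimpleTable Δ m s T) {i : ℕ} (hi : i < m) : LeftLE (σ i) Δ := by
  rw [extendOne, dif_pos hi]
  exact hT.range_eq.subset ⟨_, rfl⟩

theorem exists_index (hT : IsSimpleTable Δ m s T) {a : M} (ha : LeftLE a Δ) :
    ∃ i < m, σ i = a := by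
  obtain ⟨i, rfl⟩ := hT.range_eq.superset ha
  exact ⟨i, i.2, extendOne_val s i⟩

theorem tableDvd_iff (hT : IsSimpleTable Δ m s T) (hΔ : IsGarsideElement Δ) {a c : ℕ} :
    tableDvd T a c = true ↔ a < m ∧ c < m ∧ LeftLE (σ a) (σ c) := by
  simp only [tableDvd, List.any_eq_true, Bool.and_eq_true, beq_iff_eq, Prod.exists]
  constructor
  · rintro ⟨_, j, _, h, rfl, rfl⟩
    obtain ⟨ha, -, hc, h⟩ := hT.mem_iff.1 h
    exact ⟨ha, hc, _, h⟩
  · rintro ⟨ha, hc, x, hx⟩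
    obtain ⟨j, hj, rfl⟩ := hT.exists_index
      (hΔ.leftLE_of_mul_right (hx ▸ hT.leftLE_garside hc : LeftLE (σ a * x) Δ))
    exact ⟨a, j, c, hT.mem_iff.2 ⟨ha, hj, hc, hx⟩, rfl, rfl⟩

theorem tableOne_iff (hT : IsSimpleTable Δ m s T) (hM : IsGarsideMonoid M) {a : ℕ}
    (ha : a < m) : tableOne T a = true ↔ σ a = 1 := by
  have h : tableOne T a = true ↔ (a, a, a) ∈ T := by
    simp only [tableOne, List.any_eq_true, Bool.and_eq_true, beq_iff_eq, Prod.exists]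
    constructor
    · rintro ⟨_, _, _, h, ⟨rfl, rfl⟩, rfl⟩
      exact h
    · exact fun h => ⟨a, a, a, h, ⟨rfl, rfl⟩, rfl⟩
  simp only [h, hT.mem_iff, ha, true_and]
  exact ⟨fun h => hM.left_cancel (σ a) _ _ (by rw [h, mul_one]), fun h => by rw [h, mul_one]⟩

/-- The complements multiply up to the join. -/
theorem complement_spec (hT : IsSimpleTable Δ m s T) (hM : IsGarsideMonoid M)
    (hΔ : IsGarsideElement Δ) {a b : ℕ} (ha : a < m) (hb : b < m) :
    complement T a b < m ∧ LeftLE (σ b) (σ a * σ (complement T a b)) ∧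
      ∀ y, LeftLE (σ a) y → LeftLE (σ b) y → LeftLE (σ a * σ (complement T a b)) y := by
  obtain ⟨-, j, haj, hbj, hmin⟩ := hM.left_lattice (σ a) (σ b)
  -- `Δ` is a common upper bound, so the join divides it and occurs among the simple elements.
  obtain ⟨c, hc, rfl⟩ := hT.exists_index (hmin Δ (hT.leftLE_garside ha) (hT.leftLE_garside hb))
  have hjoin : tableJoin T a b c = true := by
    simp only [tableJoin, Bool.and_eq_true, List.all_eq_true, Bool.or_eq_true, Bool.not_eq_true',
      ← Bool.not_eq_true, hT.tableDvd_iff hΔ]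
    refine ⟨⟨⟨ha, hc, haj⟩, hb, hc, hbj⟩, fun p _ => ?_⟩
    by_cases h : (a < m ∧ p.2.2 < m ∧ LeftLE (σ a) (σ p.2.2)) ∧
      b < m ∧ p.2.2 < m ∧ LeftLE (σ b) (σ p.2.2)
    · exact Or.inr ⟨hc, h.1.2.1, hmin _ h.1.2.2 h.2.2.2⟩
    · exact Or.inl h
  have hex : ∃ p ∈ T, (p.1 == a && tableJoin T a b p.2.2) = true := by
    obtain ⟨x, hx⟩ := haj
    obtain ⟨i, hi, rfl⟩ := hT.exists_index
      (hΔ.leftLE_of_mul_right (hx ▸ hT.leftLE_garside hc : LeftLE (σ a * x) Δ))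
    exact ⟨(a, i, c), hT.mem_iff.2 ⟨ha, hi, hc, hx⟩, by simp [hjoin]⟩
  obtain ⟨⟨a', i, c'⟩, hp⟩ := Option.isSome_iff_exists.1 (List.find?_isSome.2 hex)
  have hmem := List.mem_of_find?_eq_some hp
  have hprop := List.find?_some hp
  simp only [Bool.and_eq_true, beq_iff_eq] at hprop
  obtain ⟨rfl, hj'⟩ := hprop
  obtain ⟨-, hi, hc', hmul⟩ := hT.mem_iff.1 hmem
  have hcomp : complement T a' b = i := by rw [complement, hp]; rfl
  rw [hcomp, hmul]
  simp only [tableJoin, Bool.and_eq_true, List.all_eq_true, Bool.or_eq_true, Bool.not_eq_true',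
    ← Bool.not_eq_true, hT.tableDvd_iff hΔ] at hj'
  obtain ⟨⟨-, -, -, hbc⟩, hall⟩ := hj'
  refine ⟨hi, hbc, fun y hay hby => ?_⟩
  obtain ⟨x, hx⟩ := haj
  -- The true join `c` is itself the product in some triple of `T`, so the minimality test of
  -- `tableJoin` forces the index found to divide it.
  obtain ⟨k, hk, rfl⟩ := hT.exists_index
    (hΔ.leftLE_of_mul_right (hx ▸ hT.leftLE_garside hc : LeftLE (σ a' * x) Δ))
  obtain ⟨z, hz⟩ := ((hall _ (hT.mem_iff.2 ⟨ha, hk, hc, hx⟩)).resolve_left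
    fun h => h ⟨⟨ha, hc, _, hx⟩, hb, hc, hbj⟩).2.2
  obtain ⟨y', rfl⟩ := hmin y hay hby
  exact ⟨z * y', by rw [← mul_assoc, hz]⟩

theorem complement_comm (hT : IsSimpleTable Δ m s T) (hM : IsGarsideMonoid M)
    (hΔ : IsGarsideElement Δ) {a b : ℕ} (ha : a < m) (hb : b < m) :
    σ a * σ (complement T a b) = σ b * σ (complement T b a) := by
  obtain ⟨-, h1, h2⟩ := hT.complement_spec hM hΔ ha hb
  obtain ⟨-, h3, h4⟩ := hT.complement_spec hM hΔ hb ha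
  exact hM.leftLE_antisymm (h2 _ h3 ⟨_, rfl⟩) (h4 _ h1 ⟨_, rfl⟩)

/-- In `G` the product identity reads `a⁻¹ * l = l' * a'⁻¹`. The last clause makes reversing detect
divisibility: if `a` divides `b * l`, so does the join of `a` and `b`, hence the complement of `b`
divides `l`. -/
theorem reverseLetter_spec (hT : IsSimpleTable Δ m s T) (hM : IsGarsideMonoid M)
    (hΔ : IsGarsideElement Δ) (l : List ℕ) (hl : ∀ i ∈ l, i < m) (l₀ : List ℕ) {a : ℕ}
    (ha : a < m) : ∃ l' : List ℕ, ∃ a' < m, reverseLetter T (l₀, a) l = (l₀ ++ l', a') ∧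
      (∀ i ∈ l', i < m) ∧ σ a * (l'.map σ).prod = (l.map σ).prod * σ a' ∧
      (LeftLE (σ a) (l.map σ).prod → σ a' = 1) := by
  induction l generalizing l₀ a with
  | nil =>
    refine ⟨[], a, ha, by simp [reverseLetter], by simp, by simp, ?_⟩
    rintro ⟨c, hc⟩
    exact hM.atomic.eq_one_of_mul_eq_one hc
  | cons b l ih =>
    have hb : b < m := hl b List.mem_cons_self
    obtain ⟨hab, -, -⟩ := hT.complement_spec hM hΔ ha hb
    obtain ⟨hba, -, hmin⟩ := hT.complement_spec hM hΔ hb ha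
    obtain ⟨l', a', ha', e, hl', hprod, hdvd⟩ := ih
      (fun i hi => hl i (List.mem_cons_of_mem _ hi)) (l₀ ++ [complement T a b]) hba
    refine ⟨complement T a b :: l', a', ha', ?_, ?_, ?_, ?_⟩
    · rw [List.append_cons]; exact e
    · simpa [hab] using hl'
    · rw [List.map_cons, List.prod_cons, ← mul_assoc, hT.complement_comm hM hΔ ha hb, mul_assoc,
        hprod, List.map_cons, List.prod_cons, mul_assoc]
    · intro h
      refine hdvd ?_
      rw [List.map_cons, List.prod_cons] at h
      obtain ⟨y, hy⟩ := hmin _ ⟨_, rfl⟩ h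
      exact ⟨y, hM.left_cancel (σ b) _ _ (by rw [← mul_assoc, hy])⟩

theorem toFraction_spec {G : Type*} [Group G] {ι : M →* G} (hT : IsSimpleTable Δ m s T)
    (hM : IsGarsideMonoid M) (hΔ : IsGarsideElement Δ) (w : List (ℕ × Bool))
    (hw : ∀ p ∈ w, p.1 < m) :
    (∀ i ∈ (toFraction T w).1, i < m) ∧ (∀ i ∈ (toFraction T w).2, i < m) ∧
      evalCode (fun i => ι (σ i)) w = ι ((toFraction T w).1.map σ).prod *
        (ι ((toFraction T w).2.map σ).prod)⁻¹ := by
  induction w with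
  | nil => simp [toFraction]
  | cons p w ih =>
    obtain ⟨h1, h2, he⟩ := ih fun q hq => hw q (List.mem_cons_of_mem _ hq)
    have hp : p.1 < m := hw p List.mem_cons_self
    rcases p with ⟨a, _ | _⟩
    · obtain ⟨l', a', ha', e, hl', hprod, -⟩ :=
        hT.reverseLetter_spec hM hΔ _ h1 [] hp
      have e' : toFraction T ((a, false) :: w) = (l', (toFraction T w).2 ++ [a']) := by
        rw [toFraction, List.foldr_cons, letterMul, if_neg (by simp), ← toFraction, e,
          List.nil_append]
      rw [e', evalCode_cons, he, if_neg (by simp)]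
      refine ⟨hl', ?_, ?_⟩
      · simp only [List.mem_append, List.mem_singleton]
        rintro i (hi | rfl)
        exacts [h2 i hi, ha']
      · have := congrArg ι hprod
        simp only [map_mul] at this
        simp only [List.map_append, List.map_cons, List.map_nil, List.prod_append,
          List.prod_cons, List.prod_nil, mul_one, map_mul, mul_inv_rev]
        rw [inv_mul_eq_iff_eq_mul, ← mul_assoc, ← mul_assoc, this]
        group
    · have e' : toFraction T ((a, true) :: w) = (a :: (toFraction T w).1, (toFraction T w).2) := by
        rw [toFraction, List.foldr_cons, letterMul, if_pos rfl, ← toFraction]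
      rw [e', evalCode_cons, he, if_pos rfl]
      refine ⟨by simpa [show a < m from hp] using h1, h2, ?_⟩
      simp [mul_assoc]

/-- When `b` divides `a`, each reversed letter of `b` divides what remains and leaves a trivial
denominator; the case `y = 1` is the completeness half of the word problem. -/
theorem toFraction_leftFractionWord (hT : IsSimpleTable Δ m s T) (hM : IsGarsideMonoid M)
    (hΔ : IsGarsideElement Δ) (b a : List ℕ) (hb : ∀ i ∈ b, i < m) (ha : ∀ i ∈ a, i < m)
    (y : M) (hy : (b.map σ).prod * y = (a.map σ).prod) :
    (((toFraction T (leftFractionWord b a)).1).map σ).prod = y ∧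
      ∀ i ∈ (toFraction T (leftFractionWord b a)).2, σ i = 1 := by
  have hpos : toFraction T (a.map fun i => (i, true)) = (a, []) := by
    clear ha hy
    induction a with
    | nil => rfl
    | cons i a ih =>
      have : toFraction T ((i, true) :: a.map fun i => (i, true)) =
        (i :: (toFraction T (a.map fun i => (i, true))).1,
          (toFraction T (a.map fun i => (i, true))).2) := rfl
      rw [List.map_cons, this, ih]
  rw [leftFractionWord, toFraction, List.foldr_append, ← toFraction, hpos]
  have hnil : ∀ i ∈ ([] : List ℕ), σ i = 1 := by simp
  -- The induction needs an arbitrary accumulated denominator of trivial letters.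
  generalize ([] : List ℕ) = d at hnil
  clear hpos
  induction b generalizing a d with
  | nil => exact ⟨by simpa [invWord] using hy.symm, hnil⟩
  | cons i b ih =>
    have hi : i < m := hb i List.mem_cons_self
    rw [List.map_cons, List.prod_cons, mul_assoc] at hy
    obtain ⟨l', a', ha', e, hl', hprod, hdvd⟩ := hT.reverseLetter_spec hM hΔ a ha [] hi
    have h1 := hdvd ⟨_, hy⟩
    rw [h1, mul_one, ← hy] at hprod
    rw [List.map_cons, invWord_cons, List.foldr_append, List.foldr_cons, List.foldr_nil]
    rw [letterMul, if_neg (by simp), e, List.nil_append]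
    refine ih l' (fun j hj => hb j (List.mem_cons_of_mem _ hj)) hl'
      (hM.left_cancel _ _ _ hprod).symm (d ++ [a']) ?_
    simp only [List.mem_append, List.mem_singleton]
    rintro j (hj | rfl)
    exacts [hnil j hj, h1]

/-- Two reversals are needed, since a right fraction `a * b⁻¹` with `a = b` need not be written with
equal words; reversing `b⁻¹ * a` then leaves only trivial letters. -/
theorem isTrivialWord_iff {G : Type*} [Group G] {ι : M →* G} (hT : IsSimpleTable Δ m s T)
    (hM : IsGarsideMonoid M) (hΔ : IsGarsideElement Δ) (hι : IsGroupOfFractions ι)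
    (w : List (ℕ × Bool)) (hw : ∀ p ∈ w, p.1 < m) :
    isTrivialWord T w = true ↔ evalCode (fun i => ι (σ i)) w = 1 := by
  obtain ⟨h1, h2, he⟩ := hT.toFraction_spec (ι := ι) hM hΔ w hw
  have hw' : ∀ p ∈ leftFractionWord (toFraction T w).2 (toFraction T w).1, p.1 < m := by
    simp only [leftFractionWord, invWord, List.mem_append, List.mem_reverse, List.mem_map]
    rintro _ (⟨_, ⟨i, hi, rfl⟩, rfl⟩ | ⟨i, hi, rfl⟩)
    exacts [h2 i hi, h1 i hi]
  obtain ⟨h3, h4, he'⟩ := hT.toFraction_spec (ι := ι) hM hΔ _ hw'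
  have hprod_one : ∀ l : List ℕ, (∀ i ∈ l, σ i = 1) → (l.map σ).prod = 1 := fun l hl =>
    List.prod_eq_one (by simpa using hl)
  have hone_prod : ∀ l : List ℕ, (l.map σ).prod = 1 → ∀ i ∈ l, σ i = 1 := by
    intro l
    induction l with
    | nil => simp
    | cons i l ih =>
      intro h
      rw [List.map_cons, List.prod_cons] at h
      have hi := hM.atomic.eq_one_of_mul_eq_one h
      rw [hi, one_mul] at h
      simpa [hi] using ih h
  have hfrac : evalCode (fun i => ι (σ i))
      (leftFractionWord (toFraction T w).2 (toFraction T w).1) =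
      (ι ((toFraction T w).2.map σ).prod)⁻¹ * ι ((toFraction T w).1.map σ).prod := by
    simp [leftFractionWord, map_list_prod, Function.comp_def]
  rw [he, mul_inv_eq_one]
  simp only [isTrivialWord, Bool.and_eq_true, List.all_eq_true]
  constructor
  · rintro ⟨h5, h6⟩
    rw [hfrac, hprod_one _ fun i hi => (hT.tableOne_iff hM (h3 i hi)).1 (h5 i hi),
      hprod_one _ fun i hi => (hT.tableOne_iff hM (h4 i hi)).1 (h6 i hi)] at he'
    simp only [map_one, inv_one, mul_one] at he'
    exact (inv_mul_eq_one.1 he').symm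
  · intro h
    obtain ⟨h5, h6⟩ := hT.toFraction_leftFractionWord hM hΔ _ _ h2 h1 1
      (by rw [mul_one]; exact hι.injective h.symm)
    exact ⟨fun i hi => (hT.tableOne_iff hM (h3 i hi)).2 (hone_prod _ h5 i hi),
      fun i hi => (hT.tableOne_iff hM (h4 i hi)).2 (h6 i hi)⟩

theorem evalCode_codeWord {G : Type*} [Group G] (ι : M →* G) (w : GroupWord m) :
    evalCode (fun i => ι (σ i)) (codeWord w) = evalWord (fun i => ι (s i)) w := by
  simp only [evalCode, codeWord, evalWord, List.map_map, Function.comp_def, extendOne_val]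

/-- A word found is a root by the word problem; a failed search excludes all roots by
`exists_short_root`. -/
theorem extractRoot_spec {G : Type*} [Group G] {ι : M →* G} (hT : IsSimpleTable Δ m s T)
    (hM : IsGarsideMonoid M) (hΔ : IsGarsideElement Δ) (hι : IsGroupOfFractions ι)
    (w : GroupWord m) {n : ℕ} (hn : n ≠ 0) :
    ∃ r : Option (GroupWord m), IsRootAnswer (fun i => ι (s i)) w n r ∧
      r.map codeWord = extractRoot ((m, T), codeWord w, n) := by
  have hroot : ∀ v : GroupWord m,
      isTrivialWord T (wordPow (codeWord v) n ++ invWord (codeWord w)) = true ↔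
        evalWord (fun i => ι (s i)) v ^ n = evalWord (fun i => ι (s i)) w := by
    intro v
    rw [hT.isTrivialWord_iff hM hΔ hι, evalCode_append, evalCode_wordPow, evalCode_invWord,
      evalCode_codeWord, evalCode_codeWord, mul_inv_eq_one]
    intro p hp
    rcases List.mem_append.1 hp with hp | hp
    · clear hn
      induction n with
      | zero => simp [wordPow] at hp
      | succ n ih =>
        have hp : p ∈ codeWord v ++ wordPow (codeWord v) n := hp
        rcases List.mem_append.1 hp with hp | hp
        exacts [codeWord_lt v p hp, ih (List.mem_append_left _ hp) hp]
    · simp only [invWord, List.mem_reverse, List.mem_map] at hp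
      obtain ⟨q, hq, rfl⟩ := hp
      exact codeWord_lt w q hq
  rcases hres : extractRoot ((m, T), codeWord w, n) with _ | v
  · refine ⟨none, ?_, rfl⟩
    rintro ⟨x, hx⟩
    obtain ⟨v, hv, hvw⟩ := (hι.isGarsideCone hM hΔ).exists_short_root
      (hT.range_map_eq hι) w hn hx
    have hmem : codeWord v ∈ shortWords m (rootBound m (n * (codeWord w).length)) := by
      refine mem_shortWords.2 ⟨?_, codeWord_lt v⟩
      simpa [codeWord, rootBound] using hv
    exact List.find?_eq_none.1 hres _ hmem ((hroot v).2 hvw)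
  · obtain ⟨-, hlt⟩ := mem_shortWords.1 (List.mem_of_find?_eq_some hres)
    obtain ⟨v, rfl⟩ := exists_codeWord_eq (m := m) v hlt
    have hv := List.find?_some (p := fun v =>
      isTrivialWord T (wordPow v n ++ invWord (codeWord w))) hres
    exact ⟨some v, (hroot v).1 hv, rfl⟩

end IsSimpleTable
end Correctness
end Garside

/-! ### Primitive recursiveness of the algorithm -/

namespace Garside

section Computability

variable {α β γ : Type*} [Primcodable α] [Primcodable β] [Primcodable γ]

theorem primrec_find? {f : α → List β} {p : α → β → Bool} (hf : Primrec f) (hp : Primrec₂ p) :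
    Primrec fun a => (f a).find? (p a) := by
  have h : Primrec fun a => ((f a).filterMap fun b => if p a b = true then some b else none).head? :=
    Primrec.list_head?.comp (Primrec.listFilterMap hf
      (Primrec.ite (Primrec.eq.comp hp (Primrec.const true))
        (Primrec.option_some.comp Primrec.snd) (Primrec.const none)).to₂)
  refine h.of_eq fun a => ?_
  rw [← List.head?_filter, ← List.filterMap_eq_filter]
  congr 2

theorem primrec_any {f : α → List β} {p : α → β → Bool} (hf : Primrec f) (hp : Primrec₂ p) :
    Primrec fun a => (f a).any (p a) :=
  (Primrec.option_isSome.comp (primrec_find? hf hp)).of_eq fun a => by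
    rw [Bool.eq_iff_iff]; simp

theorem primrec_all {f : α → List β} {p : α → β → Bool} (hf : Primrec f) (hp : Primrec₂ p) :
    Primrec fun a => (f a).all (p a) :=
  (Primrec.not.comp (primrec_any hf (Primrec.not.comp hp).to₂)).of_eq fun a => by
    rw [Bool.eq_iff_iff]; simp

theorem primrec_tableDvd {T : α → List (ℕ × ℕ × ℕ)} {a c : α → ℕ} (hT : Primrec T)
    (ha : Primrec a) (hc : Primrec c) : Primrec fun x => tableDvd (T x) (a x) (c x) := by
  refine primrec_any hT ?_
  exact Primrec.and.comp
    (Primrec.beq.comp (Primrec.fst.comp Primrec.snd) (ha.comp Primrec.fst))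
    (Primrec.beq.comp (Primrec.snd.comp (Primrec.snd.comp Primrec.snd)) (hc.comp Primrec.fst))

theorem primrec_tableOne {T : α → List (ℕ × ℕ × ℕ)} {a : α → ℕ} (hT : Primrec T)
    (ha : Primrec a) : Primrec fun x => tableOne (T x) (a x) := by
  refine primrec_any hT ?_
  have ha' : Primrec fun y : α × ℕ × ℕ × ℕ => a y.1 := ha.comp Primrec.fst
  exact Primrec.and.comp (Primrec.and.comp
    (Primrec.beq.comp (Primrec.fst.comp Primrec.snd) ha')
    (Primrec.beq.comp (Primrec.fst.comp (Primrec.snd.comp Primrec.snd)) ha'))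
    (Primrec.beq.comp (Primrec.snd.comp (Primrec.snd.comp Primrec.snd)) ha')

theorem primrec_tableJoin {T : α → List (ℕ × ℕ × ℕ)} {a b c : α → ℕ} (hT : Primrec T)
    (ha : Primrec a) (hb : Primrec b) (hc : Primrec c) :
    Primrec fun x => tableJoin (T x) (a x) (b x) (c x) := by
  refine Primrec.and.comp (Primrec.and.comp (primrec_tableDvd hT ha hc)
    (primrec_tableDvd hT hb hc)) (primrec_all hT ?_)
  have hl : Primrec fun y : α × ℕ × ℕ × ℕ => y.2.2.2 :=
    Primrec.snd.comp (Primrec.snd.comp Primrec.snd)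
  have hT' : Primrec fun y : α × ℕ × ℕ × ℕ => T y.1 := hT.comp Primrec.fst
  exact Primrec.or.comp (Primrec.not.comp (Primrec.and.comp
    (primrec_tableDvd hT' (ha.comp Primrec.fst) hl)
    (primrec_tableDvd hT' (hb.comp Primrec.fst) hl)))
    (primrec_tableDvd hT' (hc.comp Primrec.fst) hl)

theorem primrec_complement {T : α → List (ℕ × ℕ × ℕ)} {a b : α → ℕ} (hT : Primrec T)
    (ha : Primrec a) (hb : Primrec b) : Primrec fun x => complement (T x) (a x) (b x) := by
  refine Primrec.option_getD.comp (Primrec.option_map (primrec_find? hT ?_) ?_) (Primrec.const 0)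
  · exact Primrec.and.comp
      (Primrec.beq.comp (Primrec.fst.comp Primrec.snd) (ha.comp Primrec.fst))
      (primrec_tableJoin (hT.comp Primrec.fst) (ha.comp Primrec.fst) (hb.comp Primrec.fst)
        (Primrec.snd.comp (Primrec.snd.comp Primrec.snd)))
  · exact Primrec.fst.comp (Primrec.snd.comp Primrec.snd)

theorem primrec_reverseLetter {T : α → List (ℕ × ℕ × ℕ)} {st : α → List ℕ × ℕ} {l : α → List ℕ}
    (hT : Primrec T) (hst : Primrec st) (hl : Primrec l) :
    Primrec fun x => reverseLetter (T x) (st x) (l x) := by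
  refine Primrec.list_foldl (h := fun x y => (y.1.1 ++ [complement (T x) y.1.2 y.2],
    complement (T x) y.2 y.1.2)) hl hst ?_
  have hT' : Primrec fun y : α × (List ℕ × ℕ) × ℕ => T y.1 := hT.comp Primrec.fst
  have h1 : Primrec fun y : α × (List ℕ × ℕ) × ℕ => y.2.1.1 :=
    Primrec.fst.comp (Primrec.fst.comp Primrec.snd)
  have h2 : Primrec fun y : α × (List ℕ × ℕ) × ℕ => y.2.1.2 :=
    Primrec.snd.comp (Primrec.fst.comp Primrec.snd)
  have h3 : Primrec fun y : α × (List ℕ × ℕ) × ℕ => y.2.2 := Primrec.snd.comp Primrec.snd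
  exact (Primrec.list_concat.comp h1 (primrec_complement hT' h2 h3)).pair
    (primrec_complement hT' h3 h2)

theorem primrec_toFraction {T : α → List (ℕ × ℕ × ℕ)} {w : α → List (ℕ × Bool)}
    (hT : Primrec T) (hw : Primrec w) : Primrec fun x => toFraction (T x) (w x) := by
  refine Primrec.list_foldr (h := fun x y => letterMul (T x) y.1 y.2) hw
    (Primrec.const ([], [])) ?_
  have hp : Primrec fun y : α × (ℕ × Bool) × (List ℕ × List ℕ) => y.2.1 :=
    Primrec.fst.comp Primrec.snd
  have h1 : Primrec fun y : α × (ℕ × Bool) × (List ℕ × List ℕ) => y.2.2.1 :=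
    Primrec.fst.comp (Primrec.snd.comp Primrec.snd)
  have h2 : Primrec fun y : α × (ℕ × Bool) × (List ℕ × List ℕ) => y.2.2.2 :=
    Primrec.snd.comp (Primrec.snd.comp Primrec.snd)
  have hr := primrec_reverseLetter (hT.comp Primrec.fst)
    ((Primrec.const ([] : List ℕ)).pair (Primrec.fst.comp hp)) h1
  exact Primrec.ite (Primrec.eq.comp (Primrec.snd.comp hp) (Primrec.const true))
    ((Primrec.list_cons.comp (Primrec.fst.comp hp) h1).pair h2)
    ((Primrec.fst.comp hr).pair (Primrec.list_concat.comp h2 (Primrec.snd.comp hr)))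

theorem primrec_invWord : Primrec (invWord : List (β × Bool) → List (β × Bool)) := by
  refine Primrec.list_reverse.comp (Primrec.list_map Primrec.id ?_)
  exact (Primrec.fst.comp Primrec.snd).pair (Primrec.not.comp (Primrec.snd.comp Primrec.snd))

theorem primrec_leftFractionWord : Primrec fun x : List ℕ × List ℕ => leftFractionWord x.1 x.2 := by
  have h : Primrec fun l : List ℕ => l.map fun i => (i, true) :=
    Primrec.list_map Primrec.id
      (g := fun _ i => (i, true)) (Primrec.snd.pair (Primrec.const true))
  exact Primrec.list_append.comp (primrec_invWord.comp (h.comp Primrec.fst))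
    (h.comp Primrec.snd)

theorem primrec_isTrivialWord {T : α → List (ℕ × ℕ × ℕ)} {w : α → List (ℕ × Bool)}
    (hT : Primrec T) (hw : Primrec w) : Primrec fun x => isTrivialWord (T x) (w x) := by
  have hr := primrec_toFraction hT hw
  have hq := primrec_toFraction hT
    (primrec_leftFractionWord.comp ((Primrec.snd.comp hr).pair (Primrec.fst.comp hr)))
  have hone : Primrec₂ fun (x : α) (i : ℕ) => tableOne (T x) i :=
    primrec_tableOne (hT.comp Primrec.fst) Primrec.snd
  exact Primrec.and.comp (primrec_all (Primrec.fst.comp hq) hone)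
    (primrec_all (Primrec.snd.comp hq) hone)

theorem primrec_shortWords : Primrec fun x : ℕ × ℕ => shortWords x.1 x.2 := by
  refine Primrec.nat_rec' (h := fun (x : ℕ × ℕ) (y : ℕ × List (List (ℕ × Bool))) =>
    [] :: y.2.flatMap fun v => (List.range x.1).flatMap fun i => [(i, true) :: v, (i, false) :: v])
    Primrec.snd (Primrec.const [[]]) ?_
  refine Primrec.list_cons.comp (Primrec.const []) (Primrec.list_flatMap
    (Primrec.snd.comp Primrec.snd) ?_)
  refine Primrec.list_flatMap (Primrec.list_range.comp
    (Primrec.fst.comp (Primrec.fst.comp Primrec.fst))) ?_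
  have hl (b : Bool) : Primrec fun y : (((ℕ × ℕ) × ℕ × List (List (ℕ × Bool))) ×
      List (ℕ × Bool)) × ℕ => (y.2, b) :: y.1.2 :=
    Primrec.list_cons.comp (Primrec.snd.pair (Primrec.const b)) (Primrec.snd.comp Primrec.fst)
  exact Primrec.list_cons.comp (hl true) (Primrec.list_cons.comp (hl false) (Primrec.const []))

theorem primrec_wordPow : Primrec₂ (wordPow : List β → ℕ → List β) :=
  Primrec.nat_rec' Primrec.snd (Primrec.const [])
    (Primrec.list_append.comp (Primrec.fst.comp Primrec.fst)
      (Primrec.snd.comp Primrec.snd)).to₂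

theorem primrec_rootBound : Primrec₂ rootBound := by
  have hpow : Primrec₂ ((· ^ ·) : ℕ → ℕ → ℕ) := Primrec₂.unpaired'.1 Nat.Primrec.pow
  exact Primrec.nat_add.comp (Primrec.nat_mul.comp (Primrec.const 3) Primrec.snd)
    (Primrec.nat_mul.comp (Primrec.const 2)
      (hpow.comp Primrec.fst (Primrec.nat_mul.comp (Primrec.const 2) Primrec.snd)))

theorem primrec_extractRoot : Primrec extractRoot := by
  have hm : Primrec fun x : (ℕ × List (ℕ × ℕ × ℕ)) × List (ℕ × Bool) × ℕ => x.1.1 :=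
    Primrec.fst.comp Primrec.fst
  have hT : Primrec fun x : (ℕ × List (ℕ × ℕ × ℕ)) × List (ℕ × Bool) × ℕ => x.1.2 :=
    Primrec.snd.comp Primrec.fst
  have hw : Primrec fun x : (ℕ × List (ℕ × ℕ × ℕ)) × List (ℕ × Bool) × ℕ => x.2.1 :=
    Primrec.fst.comp Primrec.snd
  have hn : Primrec fun x : (ℕ × List (ℕ × ℕ × ℕ)) × List (ℕ × Bool) × ℕ => x.2.2 :=
    Primrec.snd.comp Primrec.snd
  refine primrec_find? (primrec_shortWords.comp (hm.pair (primrec_rootBound.comp hm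
    (Primrec.nat_mul.comp hn (Primrec.list_length.comp hw))))) ?_
  exact primrec_isTrivialWord (hT.comp Primrec.fst) (Primrec.list_append.comp
    (primrec_wordPow.comp Primrec.snd (hn.comp Primrec.fst))
    (primrec_invWord.comp (hw.comp Primrec.fst)))

end Computability

/-! ### Change of generating family -/

section Translation

variable {G : Type*} [Group G] {k l : ℕ}

/-- The translation of words that replaces the `i`-th letter by the word `u i`. -/
def substWord (u : Fin k → GroupWord l) (w : GroupWord k) : GroupWord l :=
  w.flatMap fun p => if p.2 then u p.1 else invWord (u p.1)

theorem evalWord_substWord {s : Fin k → G} {t : Fin l → G} {u : Fin k → GroupWord l}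
    (hu : ∀ i, evalWord t (u i) = s i) (w : GroupWord k) :
    evalWord t (substWord u w) = evalWord s w := by
  induction w with
  | nil => rfl
  | cons p w ih =>
    rw [substWord, List.flatMap_cons, evalWord_append, evalWord_cons, ← substWord, ih]
    rcases p with ⟨i, _ | _⟩ <;> simp [hu]

theorem primrec_substWord (u : Fin k → GroupWord l) : Primrec (substWord u) :=
  Primrec.list_flatMap Primrec.id ((Primrec.dom_finite
    fun p : Fin k × Bool => if p.2 then u p.1 else invWord (u p.1)).comp Primrec.snd).to₂

theorem primrec_codeWord : Primrec (codeWord : GroupWord k → List (ℕ × Bool)) :=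
  Primrec.list_map Primrec.id
    ((Primrec.dom_finite fun p : Fin k × Bool => ((p.1 : ℕ), p.2)).comp Primrec.snd).to₂

/-- The word in `k` letters that a list codes; the letters out of range are left out. -/
def decodeWord (k : ℕ) (v : List (ℕ × Bool)) : GroupWord k :=
  v.filterMap fun p => (List.finRange k)[p.1]?.map fun i => (i, p.2)

theorem decodeWord_codeWord (w : GroupWord k) : decodeWord k (codeWord w) = w := by
  induction w with
  | nil => rfl
  | cons p w ih =>
    rw [codeWord, List.map_cons, decodeWord, List.filterMap_cons_some (b := p) (by simp)]
    exact congrArg _ ih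

theorem primrec_decodeWord : Primrec (decodeWord k) := by
  refine Primrec.listFilterMap Primrec.id (Primrec.option_map (Primrec.list_getElem?.comp
    (Primrec.const (List.finRange k)) (Primrec.fst.comp Primrec.snd)) ?_)
  exact Primrec.snd.pair (Primrec.snd.comp (Primrec.snd.comp Primrec.fst))

/-- The solvability of the root problem does not depend on the finite generating family. -/
theorem rootProblemSolvable_of_family (t : Fin l → G) (ht : Subgroup.closure (Set.range t) = ⊤)
    (F : GroupWord l × ℕ → Option (GroupWord l)) (hF : Computable F)
    (hroot : ∀ (w : GroupWord l) (n : ℕ), 2 ≤ n → IsRootAnswer t w n (F (w, n))) :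
    RootProblemSolvable G := by
  refine ⟨(Group.fg_iff).2 ⟨_, ht, Set.finite_range t⟩, fun k s hs => ?_⟩
  -- Choosing these words costs no computability: they are finitely many and become constants of the
  -- algorithm.
  choose u hu using fun i => exists_evalWord_eq t (s i) (ht ▸ Subgroup.mem_top _)
  choose v hv using fun i => exists_evalWord_eq s (t i) (hs ▸ Subgroup.mem_top _)
  refine ⟨fun x => (F (substWord u x.1, x.2)).map (substWord v), ?_, fun w n hn => ?_⟩
  · exact Computable.option_map (hF.comp (((primrec_substWord u).comp Primrec.fst).pair
      Primrec.snd).to_comp) ((primrec_substWord v).to_comp.comp Computable.snd).to₂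
  · have h := hroot (substWord u w) n hn
    dsimp only
    rcases hF : F (substWord u w, n) with _ | y <;> rw [hF] at h
    · simpa only [IsRootAnswer, Option.map_none, evalWord_substWord hu] using h
    · simpa only [IsRootAnswer, Option.map_some, evalWord_substWord hu, evalWord_substWord hv]
        using h

end Translation

/-! ### Existence of tables and conclusion -/

/-- Every Garside monoid has a table of its simple elements. -/
theorem IsGarsideMonoid.exists_isSimpleTable {M : Type*} [Monoid M] (hM : IsGarsideMonoid M)
    (Δ : M) : ∃ (m : ℕ) (s : Fin m → M) (T : List (ℕ × ℕ × ℕ)), IsSimpleTable Δ m s T := by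
  classical
  have := (hM.finite_leftLE Δ).to_subtype
  obtain ⟨m, ⟨e⟩⟩ := Finite.exists_equiv_fin {a : M | LeftLE a Δ}
  refine ⟨m, fun i => e.symm i, ((Finset.univ.filter fun t : Fin m × Fin m × Fin m =>
    (e.symm t.1 * e.symm t.2.1 : M) = e.symm t.2.2).toList.map
      fun t => ((t.1 : ℕ), (t.2.1 : ℕ), (t.2.2 : ℕ))),
    Subtype.val_injective.comp e.symm.injective, ?_, fun t => ?_⟩
  · rw [Set.range_comp' Subtype.val e.symm, e.symm.surjective.range_eq, Set.image_univ,
      Subtype.range_coe]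
  · simp [eq_comm, Prod.exists]

theorem IsGroupOfFractions.closure_eq_top {M G : Type*} [Monoid M] [Group G] {ι : M →* G} {Δ : M}
    (hι : IsGroupOfFractions ι) (hΔ : IsGarsideElement Δ) {m : ℕ} {s : Fin m → M}
    {T : List (ℕ × ℕ × ℕ)} (hT : IsSimpleTable Δ m s T) :
    Subgroup.closure (Set.range fun i => ι (s i)) = ⊤ := by
  have hmem : ∀ a : M, ι a ∈ Subgroup.closure (Set.range fun i => ι (s i)) := fun a => by
    have ha : a ∈ Submonoid.closure {a : M | LeftLE a Δ} :=
      hΔ.closure_simples ▸ Submonoid.mem_top a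
    induction ha using Submonoid.closure_induction with
    | mem x hx =>
      obtain ⟨i, rfl⟩ := hT.range_eq.superset hx
      exact Subgroup.subset_closure ⟨i, rfl⟩
    | one => rw [map_one]; exact one_mem _
    | mul x y _ _ hx hy => rw [map_mul]; exact mul_mem hx hy
  refine (Subgroup.eq_top_iff' _).2 fun g => ?_
  obtain ⟨a, b, rfl⟩ := hι.fraction g
  exact mul_mem (hmem a) (inv_mem (hmem b))

theorem IsGarsideGroup.rootProblemSolvable {G : Type u} [Group G] (hG : IsGarsideGroup G) :
    RootProblemSolvable G := by
  obtain ⟨M, _, ι, hM, hι⟩ := hG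
  obtain ⟨Δ, hΔ⟩ := hM.exists_garside
  obtain ⟨m, s, T, hT⟩ := hM.exists_isSimpleTable Δ
  refine rootProblemSolvable_of_family (fun i => ι (s i)) (hι.closure_eq_top hΔ hT)
    (fun x => (extractRoot ((m, T), codeWord x.1, x.2)).map (decodeWord m)) ?_ fun w n hn => ?_
  · exact (Primrec.option_map (primrec_extractRoot.comp ((Primrec.const (m, T)).pair
      ((primrec_codeWord.comp Primrec.fst).pair Primrec.snd)))
      (primrec_decodeWord.comp Primrec.snd).to₂).to_comp
  · obtain ⟨r, hr, e⟩ := hT.extractRoot_spec hM hΔ hι w (n := n) (by omega)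
    have hid : decodeWord m ∘ codeWord = id := funext decodeWord_codeWord
    rw [← e, Option.map_map, hid, Option.map_id]
    exact hr

end Garside

/-- The root problem is solvable in every Garside group; moreover one algorithm solves it for all
of them, when the Garside group is given by the multiplication table of its simple elements. -/
theorem corollary8p3 :
    (∀ (G : Type u) [Group G], Garside.IsGarsideGroup G → Garside.RootProblemSolvable G) ∧
    (∃ F : (ℕ × List (ℕ × ℕ × ℕ)) × List (ℕ × Bool) × ℕ →. Option (List (ℕ × Bool)),
      Partrec F ∧
      ∀ (M G : Type u) [Monoid M] [Group G] (ι : M →* G) (Δ : M),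
        Garside.IsGarsideMonoid M → Garside.IsGroupOfFractions ι → Garside.IsGarsideElement Δ →
        ∀ (m : ℕ) (s : Fin m → M) (T : List (ℕ × ℕ × ℕ)), Garside.IsSimpleTable Δ m s T →
        ∀ (w : Garside.GroupWord m) (n : ℕ), 2 ≤ n →
          ∃ r : Option (Garside.GroupWord m),
            Garside.IsRootAnswer (fun i => ι (s i)) w n r ∧
            r.map Garside.codeWord ∈ F ((m, T), Garside.codeWord w, n)) := by
  -- The search is bounded in advance, so the uniform algorithm is total, even on lists that are not
  -- tables.
  refine ⟨fun G _ hG => hG.rootProblemSolvable, Garside.extractRoot,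
    Garside.primrec_extractRoot.to_comp.partrec, fun M G _ _ ι Δ hM hι hΔ m s T hT w n hn => ?_⟩
  obtain ⟨r, hr, e⟩ := hT.extractRoot_spec hM hΔ hι w (n := n) (by omega)
  exact ⟨r, hr, Part.mem_some_iff.2 e⟩
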